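/- Let $0<q<1$. Put $[a]_q=\dfrac{q^{a/2}-q^{-a/2}}{q^{1/2}-q^{-1/2}}$, $[k]_q!=\prod_{i=1}^k[i]_q$, $([a]_q)_k=\prod_{i=0}^{k-1}[a+i]_q$, and $c_j=j(j+1)$. Let $U_q=U_q(sl(2,\mathbb C))$ be generated by $e,f,q^{\pm h/4}$ with $q^{h/4}e=q^{1/2}eq^{h/4}$, $q^{h/4}f=q^{-1/2}fq^{h/4}$, $[e,f]=[h]_q$, and coproduct $\Delta(q^{h/4})=q^{h/4}\otimes q^{h/4}$, $\Delta(e)=e\otimes q^{h/4}+q^{-h/4}\otimes e$, $\Delta(f)=f\otimes q^{h/4}+q^{-h/4}\otimes f$. For $j\in\frac12\mathbb Z_{\ge0}$ let $V^j$ be the irreducible $U_q$-module with basis $x_{2m}$ ($m=-j,-j+1,\dots,j$), where $q^{h/4}x_{2m}=q^{m/2}x_{2m}$, $f x_{2m}=x_{2m-2}$ (and $f x_{-2j}=0$), $e x_{2m}=[j-m]_q[j+m+1]_q\,x_{2m+2}$ (and $e x_{2j}=0$). Its standard basis is $e^j_m=\bigl(([j+m+1]_q)_{j-m}[j-m]_q!\bigr)^{-1/2}x_{2m}$.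 Let $\langle\cdot,\cdot\rangle$ be the symmetric bilinear form on $V^j$ for which the $e^j_m$ are orthonormal, and use the product form on tensor products. A triple $(j_1,j_2,j)$ in $\frac12\mathbb Z_{\ge0}$ is called a triad if $|j_1-j_2|\le j\le j_1+j_2$ and $j_1+j_2+j\in\mathbb Z$; this is the condition that $V^j$ occurs in $V^{j_1}\otimes V^{j_2}$, and then it occurs exactly once. For a triad let $e^j_m(j_1,j_2)$ be the image of $e^j_m$ under the unique form-preserving intertwining map $V^j\to V^{j_1}\otimes V^{j_2}$ for which $\langle e^j_j(j_1,j_2),\,e^{j_1}_{j_1}\otimes e^{j_2}_{j-j_1}\rangle>0$. Applying this twice gives standard bases $e_m^{j_{12},j}(j_1,j_2\mid j_3)$ of the copy of $V^j$ in $V^{j_{12}}\otimes V^{j_3}\subset V^{j_1}\otimes V^{j_2}\otimes V^{j_3}$ and $e_m^{j_{23},j}(j_1\mid j_2,j_3)$ of the copy of $V^j$ in $V^{j_1}\otimes V^{j_{23}}\subset V^{j_1}\otimes V^{j_2}\otimes V^{j_3}$. The $q$-Racah coefficients ${}_qW$ are defined by $$e_m^{j_{12},j}(j_1,j_2\mid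 j_3)=\sum_{j_{23}}{}_qW^{j_2,j_3,j_{23}}_{j_{12}-j_1,\,j-j_{12},\,j-j_1}(j)\;e_m^{j_{23},j}(j_1\mid j_2,j_3),$$ where $j_{23}$ runs over the spins such that $(j_2,j_3,j_{23})$ and $(j_1,j_{23},j)$ are triads, and the $q$-$6j$ symbols by $$\begin{Bmatrix}j_3&j_1&j_{13}\\ j_2&j&j_{12}\end{Bmatrix}_q=(-1)^{j_1+j_2+j+j_3}\bigl([2j_{12}+1]_q[2j_{13}+1]_q\bigr)^{-1/2}\,{}_qW^{j_1,j_2,j_{12}}_{j_{13}-j_3,\,j-j_{13},\,j-j_3}(j),$$ whenever $(j_3,j_1,j_{13})$, $(j_{13},j_2,j)$, $(j_1,j_2,j_{12})$, $(j_3,j_{12},j)$ are triads. Let $j_1,\dots,j_9\in\frac12\mathbb Z_{\ge0}$ be such that $(j_1,j_4,j_5)$, $(j_1,j_7,j_8)$, $(j_2,j_5,j_6)$, $(j_2,j_8,j_9)$, $(j_3,j_6,j_7)$, $(j_3,j_4,j_9)$ are triads. Then $$\sum_{j_{10}}(-1)^{2j_{10}}[2j_{10}+1]_q\,q^{-(c_{j_{10}}+c_{j_8}+c_{j_6}+c_{j_4})/2}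 \begin{Bmatrix}j_2&j_7&j_{10}\\ j_1&j_9&j_8\end{Bmatrix}_q \begin{Bmatrix}j_2&j_6&j_5\\ j_3&j_{10}&j_7\end{Bmatrix}_q \begin{Bmatrix}j_1&j_5&j_4\\ j_3&j_9&j_{10}\end{Bmatrix}_q$$ $$=\sum_{j_{10}}(-1)^{2j_{10}}[2j_{10}+1]_q\,q^{-(c_{j_{10}}+c_{j_7}+c_{j_9}+c_{j_5})/2} \begin{Bmatrix}j_1&j_6&j_{10}\\ j_3&j_8&j_7\end{Bmatrix}_q \begin{Bmatrix}j_2&j_{10}&j_4\\ j_3&j_9&j_8\end{Bmatrix}_q \begin{Bmatrix}j_2&j_6&j_5\\ j_1&j_4&j_{10}\end{Bmatrix}_q ,$$ where on each side $j_{10}$ runs over all elements of $\frac12\mathbb Z_{\ge0}$ for which the three $q$-$6j$ symbols are defined, that is, on the left over those for which $(j_1,j_9,j_{10})$, $(j_2,j_7,j_{10})$, $(j_3,j_5,j_{10})$ are triads, and on the right over those for which $(j_1,j_6,j_{10})$, $(j_2,j_4,j_{10})$, $(j_3,j_8,j_{10})$ are triads. -/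

import Mathlib

open scoped TensorProduct

noncomputable section

namespace QSixJ

/-- The `q`-number `[a]_q = (q^{a/2} - q^{-a/2}) / (q^{1/2} - q^{-1/2})`. -/
def qNum (q a : ℝ) : ℝ :=
  (q ^ (a / 2) - q ^ (-a / 2)) / (q ^ ((1 : ℝ) / 2) - q ^ (-(1 : ℝ) / 2))

/-- The `q`-factorial `[k]_q! = [1]_q ⋯ [k]_q`. -/
def qFact (q : ℝ) (k : ℕ) : ℝ := ∏ i ∈ Finset.range k, qNum q (i + 1)

/-- The `q`-Pochhammer symbol `([a]_q)_k = [a]_q [a+1]_q ⋯ [a+k-1]_q`. -/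
def qPoch (q a : ℝ) (k : ℕ) : ℝ := ∏ i ∈ Finset.range k, qNum q (a + i)

/-- A module over `U_q(sl(2,ℂ))`: a complex vector space with operators
`e`, `f`, `k = q^{h/4}`, `k' = q^{-h/4}` satisfying the defining relations. -/
structure UqRep (q : ℝ) (V : Type*) [AddCommGroup V] [Module ℂ V] where
  e : Module.End ℂ V
  f : Module.End ℂ V
  k : Module.End ℂ V
  k' : Module.End ℂ V
  k_mul_k' : k * k' = 1
  k'_mul_k : k' * k = 1
  k_mul_e : k * e = ((q ^ ((1 : ℝ) / 2) : ℝ) : ℂ) • (e * k)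
  k_mul_f : k * f = ((q ^ (-(1 : ℝ) / 2) : ℝ) : ℂ) • (f * k)
  e_f : e * f - f * e =
    (((q ^ ((1 : ℝ) / 2) - q ^ (-(1 : ℝ) / 2))⁻¹ : ℝ) : ℂ) • (k * k - k' * k')

namespace UqRep

variable {q : ℝ} {V W : Type*} [AddCommGroup V] [Module ℂ V] [AddCommGroup W] [Module ℂ W]

theorem k'_mul_e (ρ : UqRep q V) (hq : 0 < q) :
    ρ.k' * ρ.e = ((q ^ (-(1 : ℝ) / 2) : ℝ) : ℂ) • (ρ.e * ρ.k') := by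
  have h : ρ.e * ρ.k' = ((q ^ ((1 : ℝ) / 2) : ℝ) : ℂ) • (ρ.k' * ρ.e) := by
    calc ρ.e * ρ.k' = ρ.k' * (ρ.k * ρ.e) * ρ.k' := by
          rw [← mul_assoc, ρ.k'_mul_k, one_mul]
      _ = _ := by
          rw [ρ.k_mul_e, mul_smul_comm, smul_mul_assoc, mul_assoc, mul_assoc, ρ.k_mul_k', mul_one]
  rw [h, smul_smul, ← Complex.ofReal_mul, ← Real.rpow_add hq]
  norm_num

theorem k'_mul_f (ρ : UqRep q V) (hq : 0 < q) :
    ρ.k' * ρ.f = ((q ^ ((1 : ℝ) / 2) : ℝ) : ℂ) • (ρ.f * ρ.k') := by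
  have h : ρ.f * ρ.k' = ((q ^ (-(1 : ℝ) / 2) : ℝ) : ℂ) • (ρ.k' * ρ.f) := by
    calc ρ.f * ρ.k' = ρ.k' * (ρ.k * ρ.f) * ρ.k' := by
          rw [← mul_assoc, ρ.k'_mul_k, one_mul]
      _ = _ := by
          rw [ρ.k_mul_f, mul_smul_comm, smul_mul_assoc, mul_assoc, mul_assoc, ρ.k_mul_k', mul_one]
  rw [h, smul_smul, ← Complex.ofReal_mul, ← Real.rpow_add hq]
  norm_num

/-- The tensor product of two modules, through the coproduct
`Δ(e) = e ⊗ q^{h/4} + q^{-h/4} ⊗ e`, `Δ(f) = f ⊗ q^{h/4} + q^{-h/4} ⊗ f`,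
`Δ(q^{h/4}) = q^{h/4} ⊗ q^{h/4}`. -/
def tensor (hq : 0 < q) (ρ : UqRep q V) (σ : UqRep q W) : UqRep q (V ⊗[ℂ] W) where
  e := TensorProduct.map ρ.e σ.k + TensorProduct.map ρ.k' σ.e
  f := TensorProduct.map ρ.f σ.k + TensorProduct.map ρ.k' σ.f
  k := TensorProduct.map ρ.k σ.k
  k' := TensorProduct.map ρ.k' σ.k'
  k_mul_k' := by
    rw [← TensorProduct.map_mul, ρ.k_mul_k', σ.k_mul_k', TensorProduct.map_one]
  k'_mul_k := by
    rw [← TensorProduct.map_mul, ρ.k'_mul_k, σ.k'_mul_k, TensorProduct.map_one]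
  k_mul_e := by
    simp only [mul_add, add_mul, ← TensorProduct.map_mul, ρ.k_mul_e, σ.k_mul_e, smul_add,
      TensorProduct.map_smul_left, TensorProduct.map_smul_right, ρ.k_mul_k', ρ.k'_mul_k]
  k_mul_f := by
    simp only [mul_add, add_mul, ← TensorProduct.map_mul, ρ.k_mul_f, σ.k_mul_f, smul_add,
      TensorProduct.map_smul_left, TensorProduct.map_smul_right, ρ.k_mul_k', ρ.k'_mul_k]
  e_f := by
    have h1 : ρ.e * ρ.f = ρ.f * ρ.e +
        (((q ^ ((1 : ℝ) / 2) - q ^ (-(1 : ℝ) / 2))⁻¹ : ℝ) : ℂ) • (ρ.k * ρ.k - ρ.k' * ρ.k') := by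
      rw [← ρ.e_f]; abel
    have h2 : σ.e * σ.f = σ.f * σ.e +
        (((q ^ ((1 : ℝ) / 2) - q ^ (-(1 : ℝ) / 2))⁻¹ : ℝ) : ℂ) • (σ.k * σ.k - σ.k' * σ.k') := by
      rw [← σ.e_f]; abel
    have n1 : ∀ (a : Module.End ℂ V) (b : Module.End ℂ W),
        TensorProduct.map (-a) b = -TensorProduct.map a b := fun a b =>
      TensorProduct.ext' fun x y => by simp [TensorProduct.neg_tmul]
    have n2 : ∀ (a : Module.End ℂ V) (b : Module.End ℂ W),
        TensorProduct.map a (-b) = -TensorProduct.map a b := fun a b =>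
      TensorProduct.ext' fun x y => by simp [TensorProduct.tmul_neg]
    simp only [mul_add, add_mul, ← TensorProduct.map_mul, σ.k_mul_f, σ.k_mul_e, ρ.k'_mul_e hq,
      ρ.k'_mul_f hq, h1, h2, TensorProduct.map_smul_left, TensorProduct.map_smul_right,
      TensorProduct.map_add_left, TensorProduct.map_add_right, sub_eq_add_neg, smul_add, smul_neg,
      n1, n2]
    abel

/-- `Φ` is an intertwining operator of `U_q`-modules. -/
structure IsIntertwining (ρ : UqRep q V) (σ : UqRep q W) (Φ : V →ₗ[ℂ] W) : Prop where
  map_e : ∀ v, Φ (ρ.e v) = σ.e (Φ v)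
  map_f : ∀ v, Φ (ρ.f v) = σ.f (Φ v)
  map_k : ∀ v, Φ (ρ.k v) = σ.k (Φ v)

end UqRep

/-- The underlying space of the irreducible module `V^j`, `j = n/2`, of dimension `n + 1`. -/
abbrev Spin (n : ℕ) : Type := Fin (n + 1) → ℂ

/-- The weight vector `x_{n-2i} = f^i · x_n` of `V^{n/2}` (zero for `i > n`). -/
def xVec (n i : ℕ) : Spin n := fun l => if (l : ℕ) = i then 1 else 0

/-- The operator on `V^{n/2}` sending `x_{n-2i}` to `g i`. -/
def ofX (n : ℕ) (g : ℕ → Spin n) : Module.End ℂ (Spin n) :=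
  (Pi.basisFun ℂ (Fin (n + 1))).constr ℂ (fun i => g i)

theorem xVec_coe (n : ℕ) (i : Fin (n + 1)) : xVec n i = Pi.basisFun ℂ (Fin (n + 1)) i := by
  ext l
  simp [xVec, Pi.single_apply, Fin.ext_iff]

theorem xVec_eq_zero {n i : ℕ} (h : n < i) : xVec n i = 0 := by
  ext l
  have := l.2
  simp only [xVec, Pi.zero_apply, ite_eq_right_iff, one_ne_zero, imp_false]
  omega

theorem ofX_xVec {n i : ℕ} (g : ℕ → Spin n) (h : i ≤ n) : ofX n g (xVec n i) = g i := by
  have := xVec_coe n ⟨i, Nat.lt_succ_of_le h⟩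
  simp only at this
  rw [this, ofX, Module.Basis.constr_basis]

theorem end_ext {n : ℕ} {M : Type*} [AddCommGroup M] [Module ℂ M] {A B : Spin n →ₗ[ℂ] M}
    (h : ∀ i ≤ n, A (xVec n i) = B (xVec n i)) : A = B := by
  refine (Pi.basisFun ℂ (Fin (n + 1))).ext fun i => ?_
  rw [← xVec_coe]
  exact h i (Nat.le_of_lt_succ i.2)

theorem qNum_zero (q : ℝ) : qNum q 0 = 0 := by simp [qNum]

theorem qNum_rel {q : ℝ} (hq : q ∈ Set.Ioo (0 : ℝ) 1) (a b : ℝ) :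
    qNum q (a + 1) * qNum q b - qNum q a * qNum q (b + 1) = qNum q (b - a) := by
  have h0 := hq.1
  have hd : q ^ ((1 : ℝ) / 2) - q ^ (-(1 : ℝ) / 2) ≠ 0 := by
    have : q ^ ((1 : ℝ) / 2) < q ^ (-(1 : ℝ) / 2) :=
      Real.rpow_lt_rpow_of_exponent_gt h0 hq.2 (by norm_num)
    linarith
  have e1 : q ^ ((a + 1) / 2) = q ^ (a / 2) * q ^ ((1 : ℝ) / 2) := by
    rw [← Real.rpow_add h0]; ring_nf
  have e2 : q ^ (-(a + 1) / 2) = (q ^ (a / 2))⁻¹ * (q ^ ((1 : ℝ) / 2))⁻¹ := by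
    rw [← Real.rpow_neg h0.le, ← Real.rpow_neg h0.le, ← Real.rpow_add h0]; ring_nf
  have e3 : q ^ ((b + 1) / 2) = q ^ (b / 2) * q ^ ((1 : ℝ) / 2) := by
    rw [← Real.rpow_add h0]; ring_nf
  have e4 : q ^ (-(b + 1) / 2) = (q ^ (b / 2))⁻¹ * (q ^ ((1 : ℝ) / 2))⁻¹ := by
    rw [← Real.rpow_neg h0.le, ← Real.rpow_neg h0.le, ← Real.rpow_add h0]; ring_nf
  have e5 : q ^ ((b - a) / 2) = q ^ (b / 2) * (q ^ (a / 2))⁻¹ := by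
    rw [← Real.rpow_neg h0.le, ← Real.rpow_add h0]; ring_nf
  have e6 : q ^ (-(b - a) / 2) = (q ^ (b / 2))⁻¹ * (q ^ (a / 2)) := by
    rw [← Real.rpow_neg h0.le, ← Real.rpow_add h0]; ring_nf
  have e7 : q ^ (-a / 2) = (q ^ (a / 2))⁻¹ := by
    rw [← Real.rpow_neg h0.le]; ring_nf
  have e8 : q ^ (-b / 2) = (q ^ (b / 2))⁻¹ := by
    rw [← Real.rpow_neg h0.le]; ring_nf
  have e9 : q ^ (-(1 : ℝ) / 2) = (q ^ ((1 : ℝ) / 2))⁻¹ := by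
    rw [← Real.rpow_neg h0.le]; ring_nf
  rw [e9] at hd
  have hA : q ^ (a / 2) ≠ 0 := (Real.rpow_pos_of_pos h0 _).ne'
  have hB : q ^ (b / 2) ≠ 0 := (Real.rpow_pos_of_pos h0 _).ne'
  have hC : q ^ ((1 : ℝ) / 2) ≠ 0 := (Real.rpow_pos_of_pos h0 _).ne'
  simp only [qNum, e1, e2, e3, e4, e5, e6, e7, e8, e9]
  generalize q ^ (a / 2) = A at *
  generalize q ^ (b / 2) = B at *
  generalize q ^ ((1 : ℝ) / 2) = C at *
  rw [div_mul_div_comm, div_mul_div_comm, div_sub_div_same, div_eq_div_iff (mul_ne_zero hd hd) hd]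
  field_simp
  ring

/-- The irreducible `U_q`-module `V^j` with `j = n/2`:
`q^{h/4} x_{n-2i} = q^{(n-2i)/4} x_{n-2i}`,
`e x_{n-2i} = [i]_q [n-i+1]_q x_{n-2i+2}`, `f x_{n-2i} = x_{n-2i-2}`, `f x_{-n} = 0`. -/
def irrep {q : ℝ} (hq : q ∈ Set.Ioo (0 : ℝ) 1) (n : ℕ) : UqRep q (Spin n) where
  e := ofX n fun i => ((qNum q i * qNum q ((n : ℝ) - i + 1) : ℝ) : ℂ) • xVec n (i - 1)
  f := ofX n fun i => xVec n (i + 1)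
  k := ofX n fun i => ((q ^ (((n : ℝ) - 2 * i) / 4) : ℝ) : ℂ) • xVec n i
  k' := ofX n fun i => ((q ^ (-((n : ℝ) - 2 * i) / 4) : ℝ) : ℂ) • xVec n i
  k_mul_k' := by
    refine end_ext fun i hi => ?_
    simp only [Module.End.mul_apply, ofX_xVec _ hi, map_smul, smul_smul, Module.End.one_apply]
    rw [← Complex.ofReal_mul, ← Real.rpow_add hq.1]
    ring_nf; simp
  k'_mul_k := by
    refine end_ext fun i hi => ?_
    simp only [Module.End.mul_apply, ofX_xVec _ hi, map_smul, smul_smul, Module.End.one_apply]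
    rw [← Complex.ofReal_mul, ← Real.rpow_add hq.1]
    ring_nf; simp
  k_mul_e := by
    refine end_ext fun i hi => ?_
    rcases i with _ | i
    · simp [ofX_xVec _ hi, qNum_zero]
    · have hi' : i ≤ n := by omega
      simp only [Module.End.mul_apply, ofX_xVec _ hi, map_smul, smul_smul, LinearMap.smul_apply,
        Nat.add_sub_cancel, ofX_xVec _ hi']
      congr 1
      have : q ^ (((n : ℝ) - 2 * i) / 4) =
          q ^ ((1 : ℝ) / 2) * q ^ (((n : ℝ) - 2 * ((i + 1 : ℕ) : ℝ)) / 4) := by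
        rw [← Real.rpow_add hq.1]; push_cast; ring_nf
      rw [this]; push_cast; ring
  k_mul_f := by
    refine end_ext fun i hi => ?_
    simp only [Module.End.mul_apply, ofX_xVec _ hi, map_smul, smul_smul, LinearMap.smul_apply]
    rcases hi.lt_or_eq with h | h
    · rw [ofX_xVec _ (show i + 1 ≤ n from h)]
      congr 1
      rw [← Complex.ofReal_mul, ← Real.rpow_add hq.1]
      push_cast; ring_nf
    · rw [xVec_eq_zero (show n < i + 1 by omega)]; simp
  e_f := by
    refine end_ext fun i hi => ?_
    have key := qNum_rel hq (i : ℝ) ((n : ℝ) - i)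
    have lhs1 : ofX n (fun i => ((qNum q i * qNum q ((n : ℝ) - i + 1) : ℝ) : ℂ) • xVec n (i - 1))
        (xVec n (i + 1)) = ((qNum q (i + 1) * qNum q ((n : ℝ) - i) : ℝ) : ℂ) • xVec n i := by
      rcases hi.lt_or_eq with h | h
      · rw [ofX_xVec _ (show i + 1 ≤ n from h)]
        simp only [Nat.add_sub_cancel]; push_cast; ring_nf
      · rw [xVec_eq_zero (show n < i + 1 by omega), h]; simp [qNum_zero]
    have lhs2 : ofX n (fun i => xVec n (i + 1)) (xVec n (i - 1)) =
        if i = 0 then xVec n 1 else xVec n i := by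
      rcases i with _ | i
      · rw [ofX_xVec _ (by omega)]; simp
      · rw [Nat.add_sub_cancel, ofX_xVec _ (by omega)]; simp
    have lhs3 : ((qNum q i * qNum q ((n : ℝ) - i + 1) : ℝ) : ℂ) •
        (if i = 0 then xVec n 1 else xVec n i) =
        ((qNum q i * qNum q ((n : ℝ) - i + 1) : ℝ) : ℂ) • xVec n i := by
      rcases i with _ | i <;> simp [qNum_zero]
    simp only [Module.End.mul_apply, LinearMap.sub_apply, ofX_xVec _ hi, map_smul, smul_smul,
      LinearMap.smul_apply, lhs1, lhs2, lhs3, ← sub_smul]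
    congr 1
    rw [← Complex.ofReal_mul, ← Complex.ofReal_mul, ← Complex.ofReal_sub, ← Complex.ofReal_sub,
      ← Complex.ofReal_mul, key, ← Real.rpow_add hq.1, ← Real.rpow_add hq.1, qNum]
    congr 1
    rw [div_eq_inv_mul]
    ring_nf

/-- `⟨x_{n-2i}, x_{n-2i}⟩ = ([n-i+1]_q)_i [i]_q!`. -/
def xNormSq (q : ℝ) (n i : ℕ) : ℝ := qPoch q ((n : ℝ) - i + 1) i * qFact q i

/-- The standard basis vector `e_m^j = x_{2m} / √(([j+m+1]_q)_{j-m} [j-m]_q!)` of `V^j`,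
where `j = n/2` and `m = j - i`. -/
def stdVec (q : ℝ) (n i : ℕ) : Spin n := (((√(xNormSq q n i))⁻¹ : ℝ) : ℂ) • xVec n i

/-- The Shapovalov form on `V^{n/2}`: the symmetric bilinear form for which the `e_m^j` are
orthonormal, that is, the `x_{n-2i}` are orthogonal with `⟨x_{n-2i}, x_{n-2i}⟩ = xNormSq q n i`. -/
def shapovalov (q : ℝ) (n : ℕ) : LinearMap.BilinForm ℂ (Spin n) :=
  Matrix.toBilin' (Matrix.diagonal fun i : Fin (n + 1) => ((xNormSq q n i : ℝ) : ℂ))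

/-- The Shapovalov form on `V^{a/2} ⊗ V^{b/2}`:
`⟨v₁ ⊗ w₁, v₂ ⊗ w₂⟩ = ⟨v₁, v₂⟩ ⟨w₁, w₂⟩`. -/
def shapovalovTensor (q : ℝ) (a b : ℕ) : LinearMap.BilinForm ℂ (Spin a ⊗[ℂ] Spin b) :=
  (shapovalov q a).tmul (shapovalov q b)

/-- The triangle condition for spins `a/2, b/2, c/2`:
`|a/2 - b/2| ≤ c/2 ≤ a/2 + b/2` and `(a + b + c)/2` is an integer. -/
def Triad (a b c : ℕ) : Prop := a ≤ b + c ∧ b ≤ a + c ∧ c ≤ a + b ∧ Even (a + b + c)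

instance (a b c : ℕ) : Decidable (Triad a b c) := by unfold Triad; infer_instance

/-- `Φ : V^j → V^{j₁} ⊗ V^{j₂}` (with `j₁ = a/2`, `j₂ = b/2`, `j = c/2`) sends `e_m^j` to the
standard basis vectors `e_m^j(j₁, j₂)` of the copy of `V^j` in `V^{j₁} ⊗ V^{j₂}`: it intertwines
the actions, respects the Shapovalov forms, and is normalized by
`⟨e_j^j(j₁, j₂), e_{j₁}^{j₁} ⊗ e_{j-j₁}^{j₂}⟩ > 0`. -/
structure IsStdEmbedding {q : ℝ} (hq : q ∈ Set.Ioo (0 : ℝ) 1) (a b c : ℕ)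
    (Φ : Spin c →ₗ[ℂ] Spin a ⊗[ℂ] Spin b) : Prop where
  intertwining : (irrep hq c).IsIntertwining (UqRep.tensor hq.1 (irrep hq a) (irrep hq b)) Φ
  isometry : ∀ v w, shapovalovTensor q a b (Φ v) (Φ w) = shapovalov q c v w
  positive : ∃ r : ℝ, 0 < r ∧
    shapovalovTensor q a b (Φ (stdVec q c 0)) (stdVec q a 0 ⊗ₜ stdVec q b ((a + b - c) / 2)) = r

theorem shapovalov_xVec (q : ℝ) (n i j : ℕ) (hi : i ≤ n) :
    shapovalov q n (xVec n i) (xVec n j) = if i = j then ((xNormSq q n i : ℝ) : ℂ) else 0 := by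
  rw [shapovalov, Matrix.toBilin'_apply', dotProduct,
    Finset.sum_eq_single ⟨i, Nat.lt_succ_of_le hi⟩]
  · simp [xVec, Matrix.mulVec_diagonal]
  · intro l _ h
    have : (l : ℕ) ≠ i := fun h' => h (Fin.ext h')
    simp [xVec, this]
  · simp

theorem qNum_pos {q : ℝ} (hq : q ∈ Set.Ioo (0 : ℝ) 1) {a : ℝ} (ha : 0 < a) : 0 < qNum q a := by
  have h1 : q ^ (a / 2) < q ^ (-a / 2) :=
    Real.rpow_lt_rpow_of_exponent_gt hq.1 hq.2 (by linarith)
  have h2 : q ^ ((1 : ℝ) / 2) < q ^ (-(1 : ℝ) / 2) :=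
    Real.rpow_lt_rpow_of_exponent_gt hq.1 hq.2 (by norm_num)
  exact div_pos_of_neg_of_neg (by linarith) (by linarith)

theorem xNormSq_pos {q : ℝ} (hq : q ∈ Set.Ioo (0 : ℝ) 1) {n i : ℕ} (h : i ≤ n) :
    0 < xNormSq q n i := by
  have : (i : ℝ) ≤ n := by exact_mod_cast h
  exact mul_pos (Finset.prod_pos fun t _ => qNum_pos hq (by have : (0 : ℝ) ≤ (t : ℝ) := t.cast_nonneg; linarith))
    (Finset.prod_pos fun t _ => qNum_pos hq (by positivity))

theorem shapovalov_ext {n : ℕ} {A B : Spin n →ₗ[ℂ] Spin n →ₗ[ℂ] ℂ}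
    (h : ∀ i ≤ n, ∀ j ≤ n, A (xVec n i) (xVec n j) = B (xVec n i) (xVec n j)) : A = B :=
  end_ext fun i hi => end_ext fun j hj => h i hi j hj

theorem xNormSq_succ (q : ℝ) (n i : ℕ) :
    xNormSq q n (i + 1) = qNum q (i + 1) * qNum q ((n : ℝ) - i) * xNormSq q n i := by
  have h : qPoch q ((n : ℝ) - ((i + 1 : ℕ) : ℝ) + 1) (i + 1) =
      qNum q ((n : ℝ) - i) * qPoch q ((n : ℝ) - i + 1) i := by
    rw [qPoch, Finset.prod_range_succ', mul_comm]
    congr 1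
    · push_cast; ring_nf
    · refine Finset.prod_congr rfl fun t _ => ?_
      push_cast; ring_nf
  rw [xNormSq, h, qFact, Finset.prod_range_succ, xNormSq, qFact]
  ring

theorem irrep_e {q : ℝ} (hq : q ∈ Set.Ioo (0 : ℝ) 1) {n i : ℕ} (h : i ≤ n) :
    (irrep hq n).e (xVec n i) =
      ((qNum q i * qNum q ((n : ℝ) - i + 1) : ℝ) : ℂ) • xVec n (i - 1) := by
  simp only [irrep]
  rw [ofX_xVec _ h]

theorem irrep_f {q : ℝ} (hq : q ∈ Set.Ioo (0 : ℝ) 1) {n i : ℕ} :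
    (irrep hq n).f (xVec n i) = xVec n (i + 1) := by
  rcases le_or_gt i n with h | h
  · simp only [irrep]
    rw [ofX_xVec _ h]
  · rw [xVec_eq_zero h, xVec_eq_zero (by omega), map_zero]

theorem irrep_k {q : ℝ} (hq : q ∈ Set.Ioo (0 : ℝ) 1) {n i : ℕ} :
    (irrep hq n).k (xVec n i) = ((q ^ (((n : ℝ) - 2 * i) / 4) : ℝ) : ℂ) • xVec n i := by
  rcases le_or_gt i n with h | h
  · simp only [irrep]
    rw [ofX_xVec _ h]
  · rw [xVec_eq_zero h, map_zero, smul_zero]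

theorem irrep_k' {q : ℝ} (hq : q ∈ Set.Ioo (0 : ℝ) 1) {n i : ℕ} :
    (irrep hq n).k' (xVec n i) = ((q ^ (-((n : ℝ) - 2 * i) / 4) : ℝ) : ℂ) • xVec n i := by
  rcases le_or_gt i n with h | h
  · simp only [irrep]
    rw [ofX_xVec _ h]
  · rw [xVec_eq_zero h, map_zero, smul_zero]

theorem shapovalov_e {q : ℝ} (hq : q ∈ Set.Ioo (0 : ℝ) 1) (n : ℕ) (v w : Spin n) :
    shapovalov q n ((irrep hq n).e v) w = shapovalov q n v ((irrep hq n).f w) := by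
  have : (shapovalov q n) ∘ₗ (irrep hq n).e = LinearMap.compl₂ (shapovalov q n) (irrep hq n).f := by
    refine shapovalov_ext fun i hi j hj => ?_
    simp only [LinearMap.comp_apply, LinearMap.compl₂_apply, irrep_e hq hi, irrep_f, map_smul,
      LinearMap.smul_apply, shapovalov_xVec q n i _ hi,
      shapovalov_xVec q n (i - 1) _ (by omega : i - 1 ≤ n)]
    rcases i with _ | i
    · simp [qNum_zero]
    · rw [Nat.add_sub_cancel]
      by_cases hij : i = j
      · subst hij
        rw [if_pos rfl, if_pos rfl, xNormSq_succ]
        push_cast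
        rw [smul_eq_mul]
        ring_nf
      · rw [if_neg hij, if_neg (by omega), smul_zero]
  exact LinearMap.congr_fun₂ this v w

theorem shapovalov_k {q : ℝ} (hq : q ∈ Set.Ioo (0 : ℝ) 1) (n : ℕ) (v w : Spin n) :
    shapovalov q n ((irrep hq n).k v) w = shapovalov q n v ((irrep hq n).k w) := by
  have : (shapovalov q n) ∘ₗ (irrep hq n).k = LinearMap.compl₂ (shapovalov q n) (irrep hq n).k := by
    refine shapovalov_ext fun i hi j hj => ?_
    simp only [LinearMap.comp_apply, LinearMap.compl₂_apply, irrep_k, map_smul,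
      LinearMap.smul_apply, shapovalov_xVec q n i _ hi]
    by_cases hij : i = j <;> simp [hij]
  exact LinearMap.congr_fun₂ this v w

theorem shapovalov_k' {q : ℝ} (hq : q ∈ Set.Ioo (0 : ℝ) 1) (n : ℕ) (v w : Spin n) :
    shapovalov q n ((irrep hq n).k' v) w = shapovalov q n v ((irrep hq n).k' w) := by
  have : (shapovalov q n) ∘ₗ (irrep hq n).k' = LinearMap.compl₂ (shapovalov q n) (irrep hq n).k' := by
    refine shapovalov_ext fun i hi j hj => ?_
    simp only [LinearMap.comp_apply, LinearMap.compl₂_apply, irrep_k', map_smul,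
      LinearMap.smul_apply, shapovalov_xVec q n i _ hi]
    by_cases hij : i = j <;> simp [hij]
  exact LinearMap.congr_fun₂ this v w

theorem shapovalovTensor_tmul (q : ℝ) (a b : ℕ) (v v' : Spin a) (w w' : Spin b) :
    shapovalovTensor q a b (v ⊗ₜ w) (v' ⊗ₜ w') = shapovalov q a v v' * shapovalov q b w w' := by
  simp [shapovalovTensor, LinearMap.BilinForm.tmul, mul_comm]

theorem shapovalovTensor_e {q : ℝ} (hq : q ∈ Set.Ioo (0 : ℝ) 1) (a b : ℕ)
    (v w : Spin a ⊗[ℂ] Spin b) :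
    shapovalovTensor q a b ((UqRep.tensor hq.1 (irrep hq a) (irrep hq b)).e v) w =
      shapovalovTensor q a b v ((UqRep.tensor hq.1 (irrep hq a) (irrep hq b)).f w) := by
  induction v using TensorProduct.induction_on with
  | zero => simp
  | add x y hx hy => simp only [map_add, LinearMap.add_apply, hx, hy]
  | tmul x y =>
    induction w using TensorProduct.induction_on with
    | zero => simp
    | add x y hx hy => simp only [map_add, hx, hy]
    | tmul x' y' =>
      simp only [UqRep.tensor, LinearMap.add_apply, TensorProduct.map_tmul, map_add,
        shapovalovTensor_tmul, shapovalov_e, shapovalov_k, shapovalov_k']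

theorem shapovalovTensor_k {q : ℝ} (hq : q ∈ Set.Ioo (0 : ℝ) 1) (a b : ℕ)
    (v w : Spin a ⊗[ℂ] Spin b) :
    shapovalovTensor q a b ((UqRep.tensor hq.1 (irrep hq a) (irrep hq b)).k v) w =
      shapovalovTensor q a b v ((UqRep.tensor hq.1 (irrep hq a) (irrep hq b)).k w) := by
  induction v using TensorProduct.induction_on with
  | zero => simp
  | add x y hx hy => simp only [map_add, LinearMap.add_apply, hx, hy]
  | tmul x y =>
    induction w using TensorProduct.induction_on with
    | zero => simp
    | add x y hx hy => simp only [map_add, hx, hy]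
    | tmul x' y' =>
      simp only [UqRep.tensor, TensorProduct.map_tmul, shapovalovTensor_tmul, shapovalov_k]

/-- The action of `e` on the vectors `f^i v`, for a highest weight vector `v`. -/
theorem UqRep.e_f_pow {q : ℝ} (hq : q ∈ Set.Ioo (0 : ℝ) 1) {V : Type*} [AddCommGroup V]
    [Module ℂ V] (ρ : UqRep q V) (c : ℝ) (v : V) (he : ρ.e v = 0)
    (hk : ρ.k v = ((q ^ (c / 4) : ℝ) : ℂ) • v) (i : ℕ) :
    ρ.k ((ρ.f ^ i) v) = ((q ^ ((c - 2 * i) / 4) : ℝ) : ℂ) • (ρ.f ^ i) v ∧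
    ρ.e ((ρ.f ^ i) v) = ((qNum q i * qNum q (c - i + 1) : ℝ) : ℂ) • (ρ.f ^ (i - 1)) v := by
  have hk1 : ∀ i : ℕ, ρ.k ((ρ.f ^ i) v) = ((q ^ ((c - 2 * i) / 4) : ℝ) : ℂ) • (ρ.f ^ i) v := by
    intro i
    induction i with
    | zero => simpa using hk
    | succ i ih =>
      have := LinearMap.congr_fun ρ.k_mul_f ((ρ.f ^ i) v)
      simp only [Module.End.mul_apply, LinearMap.smul_apply, ih, map_smul, smul_smul] at this
      rw [pow_succ', Module.End.mul_apply, this]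
      congr 1
      rw [← Complex.ofReal_mul, ← Real.rpow_add hq.1]
      push_cast; ring_nf
  have hk2 : ∀ i : ℕ, ρ.k' ((ρ.f ^ i) v) = ((q ^ (-(c - 2 * i) / 4) : ℝ) : ℂ) • (ρ.f ^ i) v := by
    intro i
    have h1 := LinearMap.congr_fun ρ.k'_mul_k ((ρ.f ^ i) v)
    simp only [Module.End.mul_apply, hk1, map_smul, Module.End.one_apply] at h1
    conv_rhs => rw [← h1, smul_smul, ← Complex.ofReal_mul, ← Real.rpow_add hq.1]
    ring_nf; simp
  refine ⟨hk1 i, ?_⟩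
  induction i with
  | zero => simp [he, qNum_zero]
  | succ i ih =>
    have h := LinearMap.congr_fun ρ.e_f ((ρ.f ^ i) v)
    simp only [Module.End.mul_apply, LinearMap.smul_apply, LinearMap.sub_apply, ih, map_smul,
      smul_smul, hk1, hk2, ← sub_smul] at h
    have h2 : ((qNum q i * qNum q (c - i + 1) : ℝ) : ℂ) • ρ.f ((ρ.f ^ (i - 1)) v) =
        ((qNum q i * qNum q (c - i + 1) : ℝ) : ℂ) • (ρ.f ^ i) v := by
      rcases i with _ | i
      · simp [qNum_zero]
      · rw [Nat.add_sub_cancel, pow_succ' ρ.f i, Module.End.mul_apply]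
    rw [h2, sub_eq_iff_eq_add, ← add_smul] at h
    rw [pow_succ', Module.End.mul_apply, h, Nat.add_sub_cancel]
    congr 1
    have key := qNum_rel hq (i : ℝ) (c - i)
    have : qNum q ((c - i) - i) = (q ^ ((1 : ℝ) / 2) - q ^ (-(1 : ℝ) / 2))⁻¹ *
        (q ^ ((c - 2 * i) / 4) * q ^ ((c - 2 * i) / 4) -
          q ^ (-(c - 2 * i) / 4) * q ^ (-(c - 2 * i) / 4)) := by
      rw [← Real.rpow_add hq.1, ← Real.rpow_add hq.1, qNum, div_eq_inv_mul]
      ring_nf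
    rw [← Complex.ofReal_mul, ← Complex.ofReal_mul, ← Complex.ofReal_sub, ← Complex.ofReal_mul,
      ← Complex.ofReal_add, ← this, ← key]
    push_cast
    ring_nf

/-- Vectors of `V^{a/2} ⊗ V^{b/2}` with real coordinates. -/
def IsRealVec (a b : ℕ) (v : Spin a ⊗[ℂ] Spin b) : Prop :=
  ∃ C : Fin (a + 1) → Fin (b + 1) → ℝ,
    v = ∑ i, ∑ j, ((C i j : ℝ) : ℂ) • (xVec a i ⊗ₜ[ℂ] xVec b j)

theorem IsRealVec.zero (a b : ℕ) : IsRealVec a b 0 := ⟨0, by simp⟩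

theorem IsRealVec.add {a b : ℕ} {v w} (hv : IsRealVec a b v) (hw : IsRealVec a b w) :
    IsRealVec a b (v + w) := by
  obtain ⟨C, rfl⟩ := hv
  obtain ⟨D, rfl⟩ := hw
  exact ⟨C + D, by
    simp only [Pi.add_apply, Complex.ofReal_add, add_smul, Finset.sum_add_distrib]⟩

theorem IsRealVec.smul {a b : ℕ} {v} (r : ℝ) (hv : IsRealVec a b v) :
    IsRealVec a b ((r : ℂ) • v) := by
  obtain ⟨C, rfl⟩ := hv
  exact ⟨r • C, by simp [Finset.smul_sum, smul_smul]⟩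

theorem IsRealVec.sum {a b : ℕ} {ι : Type*} (s : Finset ι) (v : ι → Spin a ⊗[ℂ] Spin b)
    (h : ∀ i ∈ s, IsRealVec a b (v i)) : IsRealVec a b (∑ i ∈ s, v i) :=
  Finset.sum_induction _ _ (fun _ _ => IsRealVec.add) (IsRealVec.zero a b) h

theorem IsRealVec.xVec (a b i j : ℕ) : IsRealVec a b (xVec a i ⊗ₜ QSixJ.xVec b j) := by
  rcases le_or_gt i a with hi | hi
  · rcases le_or_gt j b with hj | hj
    · refine ⟨fun i' j' => if (i' : ℕ) = i ∧ (j' : ℕ) = j then 1 else 0, ?_⟩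
      rw [Finset.sum_eq_single ⟨i, Nat.lt_succ_of_le hi⟩,
        Finset.sum_eq_single ⟨j, Nat.lt_succ_of_le hj⟩]
      · simp
      · intro j' _ h
        have : (j' : ℕ) ≠ j := fun h' => h (Fin.ext h')
        simp [this]
      · simp
      · intro i' _ h
        have : (i' : ℕ) ≠ i := fun h' => h (Fin.ext h')
        simp [this]
      · simp
    · rw [xVec_eq_zero hj, TensorProduct.tmul_zero]; exact .zero a b
  · rw [xVec_eq_zero hi, TensorProduct.zero_tmul]; exact .zero a b

theorem IsRealVec.f {q : ℝ} (hq : q ∈ Set.Ioo (0 : ℝ) 1) {a b : ℕ} {v} (hv : IsRealVec a b v) :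
    IsRealVec a b ((UqRep.tensor hq.1 (irrep hq a) (irrep hq b)).f v) := by
  obtain ⟨C, rfl⟩ := hv
  simp only [map_sum, map_smul]
  refine .sum _ _ fun i _ => .sum _ _ fun j _ => .smul _ ?_
  simp only [UqRep.tensor, LinearMap.add_apply, TensorProduct.map_tmul, irrep_f, irrep_k, irrep_k',
    TensorProduct.tmul_smul, TensorProduct.smul_tmul']
  exact .add (.smul _ (.xVec _ _ _ _)) (.smul _ (.xVec _ _ _ _))

theorem shapovalovTensor_sum {q : ℝ} (a b : ℕ) (C : Fin (a + 1) → Fin (b + 1) → ℝ)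
    (i : Fin (a + 1)) (j : Fin (b + 1)) :
    shapovalovTensor q a b (xVec a i ⊗ₜ xVec b j)
      (∑ i, ∑ j, ((C i j : ℝ) : ℂ) • (xVec a i ⊗ₜ[ℂ] xVec b j)) =
      ((C i j * (xNormSq q a i * xNormSq q b j) : ℝ) : ℂ) := by
  simp only [map_sum, map_smul, shapovalovTensor_tmul,
    shapovalov_xVec q a i _ (Nat.le_of_lt_succ i.2), shapovalov_xVec q b j _ (Nat.le_of_lt_succ j.2)]
  rw [Finset.sum_eq_single i, Finset.sum_eq_single j]
  · simp
  · intro j' _ h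
    have : (j : ℕ) ≠ j' := fun h' => h (Fin.ext h').symm
    simp [this]
  · simp
  · intro i' _ h
    have : (i : ℕ) ≠ i' := fun h' => h (Fin.ext h').symm
    simp [this]
  · simp

/-- The Shapovalov form is positive definite on real vectors. -/
theorem IsRealVec.normSq {q : ℝ} (hq : q ∈ Set.Ioo (0 : ℝ) 1) {a b : ℕ} {v}
    (hv : IsRealVec a b v) :
    v = 0 ∨ ∃ r : ℝ, 0 < r ∧ shapovalovTensor q a b v v = r := by
  obtain ⟨C, rfl⟩ := hv
  have hpos : ∀ (i : Fin (a + 1)) (j : Fin (b + 1)), 0 < xNormSq q a i * xNormSq q b j :=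
    fun i j => mul_pos (xNormSq_pos hq (Nat.le_of_lt_succ i.2))
      (xNormSq_pos hq (Nat.le_of_lt_succ j.2))
  have hs : shapovalovTensor q a b
      (∑ i, ∑ j, ((C i j : ℝ) : ℂ) • (QSixJ.xVec a i ⊗ₜ[ℂ] QSixJ.xVec b j))
      (∑ i, ∑ j, ((C i j : ℝ) : ℂ) • (QSixJ.xVec a i ⊗ₜ[ℂ] QSixJ.xVec b j)) =
      ((∑ i, ∑ j, C i j ^ 2 * (xNormSq q a i * xNormSq q b j) : ℝ) : ℂ) := by
    conv_lhs => enter [1]; simp only [map_sum, map_smul]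
    simp only [LinearMap.sum_apply, LinearMap.smul_apply, shapovalovTensor_sum]
    push_cast
    simp only [smul_eq_mul]
    refine Finset.sum_congr rfl fun i _ => Finset.sum_congr rfl fun j _ => by ring
  by_cases h : ∀ i j, C i j = 0
  · left; simp [h]
  · right
    push Not at h
    obtain ⟨i, j, hij⟩ := h
    refine ⟨_, ?_, hs⟩
    have hn : ∀ i j, 0 ≤ C i j ^ 2 * (xNormSq q a i * xNormSq q b j) :=
      fun i j => mul_nonneg (sq_nonneg _) (hpos i j).le
    refine Finset.sum_pos' (fun i _ => Finset.sum_nonneg fun j _ => hn i j)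
      ⟨i, Finset.mem_univ _, Finset.sum_pos' (fun j _ => hn i j) ⟨j, Finset.mem_univ _, ?_⟩⟩
    exact mul_pos (by positivity) (hpos i j)

/-- Coefficients of the highest weight vector of `V^{(a+b-2l)/2}` in `V^{a/2} ⊗ V^{b/2}`. -/
def hwCoeff (q : ℝ) (a b l : ℕ) : ℕ → ℝ
  | 0 => 1
  | k + 1 => -(hwCoeff q a b l k *
      (q ^ (-((a : ℝ) - 2 * k) / 4) *
        (qNum q ((l - k : ℕ) : ℝ) * qNum q ((b : ℝ) - ((l - k : ℕ) : ℝ) + 1)))) /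
      (qNum q ((k + 1 : ℕ) : ℝ) * qNum q ((a : ℝ) - ((k + 1 : ℕ) : ℝ) + 1) *
        q ^ (((b : ℝ) - 2 * ((l - (k + 1) : ℕ) : ℝ)) / 4))

/-- The highest weight vector of `V^{(a+b-2l)/2}` in `V^{a/2} ⊗ V^{b/2}`. -/
def hwVec (q : ℝ) (a b l : ℕ) : Spin a ⊗[ℂ] Spin b :=
  ∑ k ∈ Finset.range (l + 1), ((hwCoeff q a b l k : ℝ) : ℂ) • (xVec a k ⊗ₜ[ℂ] xVec b (l - k))

theorem hwVec_e {q : ℝ} (hq : q ∈ Set.Ioo (0 : ℝ) 1) {a b l : ℕ} (ha : l ≤ a) (hb : l ≤ b) :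
    (UqRep.tensor hq.1 (irrep hq a) (irrep hq b)).e (hwVec q a b l) = 0 := by
  have h1 : ∀ k ∈ Finset.range (l + 1),
      ((hwCoeff q a b l k : ℝ) : ℂ) • (UqRep.tensor hq.1 (irrep hq a) (irrep hq b)).e
        (xVec a k ⊗ₜ[ℂ] xVec b (l - k)) =
      ((hwCoeff q a b l k * (qNum q (k : ℝ) * qNum q ((a : ℝ) - (k : ℝ) + 1) *
        q ^ (((b : ℝ) - 2 * ((l - k : ℕ) : ℝ)) / 4)) : ℝ) : ℂ) •
          (xVec a (k - 1) ⊗ₜ[ℂ] xVec b (l - k)) +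
      ((hwCoeff q a b l k * (q ^ (-((a : ℝ) - 2 * k) / 4) *
        (qNum q ((l - k : ℕ) : ℝ) * qNum q ((b : ℝ) - ((l - k : ℕ) : ℝ) + 1))) : ℝ) : ℂ) •
          (xVec a k ⊗ₜ[ℂ] xVec b (l - k - 1)) := by
    intro k hk
    have hk' : k ≤ l := Nat.le_of_lt_succ (Finset.mem_range.1 hk)
    simp only [UqRep.tensor, LinearMap.add_apply, TensorProduct.map_tmul,
      irrep_e hq (hk'.trans ha), irrep_k, irrep_k', irrep_e hq ((Nat.sub_le l k).trans hb),
      TensorProduct.smul_tmul_smul, smul_add, smul_smul]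
    push_cast
    rfl
  rw [hwVec, map_sum]
  simp only [map_smul]
  rw [Finset.sum_congr rfl h1, Finset.sum_add_distrib, Finset.sum_range_succ',
    Finset.sum_range_succ (fun k => ((hwCoeff q a b l k * (q ^ (-((a : ℝ) - 2 * k) / 4) *
        (qNum q ((l - k : ℕ) : ℝ) * qNum q ((b : ℝ) - ((l - k : ℕ) : ℝ) + 1))) : ℝ) : ℂ) •
          (xVec a k ⊗ₜ[ℂ] xVec b (l - k - 1)))]
  simp only [Nat.sub_self, Nat.cast_zero, qNum_zero, zero_mul, mul_zero, Complex.ofReal_zero,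
    zero_smul, add_zero]
  rw [← Finset.sum_add_distrib]
  refine Finset.sum_eq_zero fun k hk => ?_
  have hk' : k < l := Finset.mem_range.1 hk
  have hka : ((k + 1 : ℕ) : ℝ) ≤ a := by exact_mod_cast (show k + 1 ≤ a by omega)
  rw [Nat.add_sub_cancel, show l - k - 1 = l - (k + 1) by omega, ← add_smul, ← Complex.ofReal_add]
  have hne : qNum q ((k + 1 : ℕ) : ℝ) * qNum q ((a : ℝ) - ((k + 1 : ℕ) : ℝ) + 1) *
        q ^ (((b : ℝ) - 2 * ((l - (k + 1) : ℕ) : ℝ)) / 4) ≠ 0 :=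
    (mul_pos (mul_pos (qNum_pos hq (by positivity)) (qNum_pos hq (by linarith)))
      (Real.rpow_pos_of_pos hq.1 _)).ne'
  rw [hwCoeff, div_mul_cancel₀ _ hne, neg_add_cancel]
  simp

theorem hwVec_k {q : ℝ} (hq : q ∈ Set.Ioo (0 : ℝ) 1) {a b c l : ℕ} (h : c + 2 * l = a + b) :
    (UqRep.tensor hq.1 (irrep hq a) (irrep hq b)).k (hwVec q a b l) =
      ((q ^ ((c : ℝ) / 4) : ℝ) : ℂ) • hwVec q a b l := by
  rw [hwVec, map_sum, Finset.smul_sum]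
  refine Finset.sum_congr rfl fun k hk => ?_
  have hk' : k ≤ l := Nat.le_of_lt_succ (Finset.mem_range.1 hk)
  have hc : (c : ℝ) = a + b - 2 * l := by
    have : (c : ℝ) + 2 * l = a + b := by exact_mod_cast h
    linarith
  simp only [map_smul, UqRep.tensor, TensorProduct.map_tmul, irrep_k, TensorProduct.smul_tmul_smul]
  rw [smul_comm]
  congr 1
  rw [← Complex.ofReal_mul, ← Real.rpow_add hq.1, hc, Nat.cast_sub hk']
  ring_nf

theorem hwVec_real (q : ℝ) (a b l : ℕ) : IsRealVec a b (hwVec q a b l) :=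
  .sum _ _ fun _ _ => .smul _ (.xVec _ _ _ _)

theorem hwVec_top (q : ℝ) {a b l : ℕ} (ha : l ≤ a) (hb : l ≤ b) :
    shapovalovTensor q a b (hwVec q a b l) (xVec a 0 ⊗ₜ xVec b l) =
      ((xNormSq q a 0 * xNormSq q b l : ℝ) : ℂ) := by
  simp only [hwVec, map_sum, LinearMap.sum_apply, map_smul, LinearMap.smul_apply,
    shapovalovTensor_tmul]
  rw [Finset.sum_eq_single 0]
  · rw [shapovalov_xVec q a 0 0 (by omega), shapovalov_xVec q b _ l (by omega)]
    simp [hwCoeff]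
  · intro k hk h0
    have hk' : k ≤ l := Nat.le_of_lt_succ (Finset.mem_range.1 hk)
    rw [shapovalov_xVec q a k 0 (by omega), if_neg h0]
    simp
  · simp

/-- For an admissible triple the standard embedding exists. -/
theorem exists_isStdEmbedding {q : ℝ} (hq : q ∈ Set.Ioo (0 : ℝ) 1) {a b c : ℕ}
    (h : Triad a b c) : ∃ Φ, IsStdEmbedding hq a b c Φ := by
  obtain ⟨h1, h2, h3, m, hm⟩ := h
  set l := (a + b - c) / 2 with hl
  have hc : c + 2 * l = a + b := by omega
  have ha : l ≤ a := by omega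
  have hb : l ≤ b := by omega
  set T := UqRep.tensor hq.1 (irrep hq a) (irrep hq b) with hT
  set w := hwVec q a b l with hw
  have hpow := fun i => T.e_f_pow hq (c : ℝ) w (hwVec_e hq ha hb) (hwVec_k hq hc) i
  have hreal : ∀ i : ℕ, IsRealVec a b ((T.f ^ i) w) := by
    intro i
    induction i with
    | zero => exact hwVec_real q a b l
    | succ i ih => rw [pow_succ', Module.End.mul_apply]; exact ih.f hq
  have hN : 0 < xNormSq q a 0 * xNormSq q b l :=
    mul_pos (xNormSq_pos hq (by omega)) (xNormSq_pos hq hb)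
  have hw0 : w ≠ 0 := by
    intro h0
    have := hwVec_top q ha hb
    rw [← hw, h0] at this
    simp only [map_zero, LinearMap.zero_apply] at this
    exact hN.ne' (by exact_mod_cast this.symm)
  obtain ⟨r, hr, hwr⟩ := ((hreal 0).normSq hq).resolve_left (by simpa using hw0)
  simp only [pow_zero, Module.End.one_apply] at hwr
  have hstep : ∀ i : ℕ, shapovalovTensor q a b ((T.f ^ (i + 1)) w) ((T.f ^ (i + 1)) w) =
      ((qNum q (i + 1) * qNum q ((c : ℝ) - i) : ℝ) : ℂ) *
        shapovalovTensor q a b ((T.f ^ i) w) ((T.f ^ i) w) := by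
    intro i
    conv_lhs => enter [2]; rw [pow_succ', Module.End.mul_apply]
    rw [hT, ← shapovalovTensor_e hq, ← hT, (hpow (i + 1)).2, Nat.add_sub_cancel, map_smul,
      LinearMap.smul_apply, smul_eq_mul]
    push_cast
    ring_nf
  have hlast : (T.f ^ (c + 1)) w = 0 := by
    rcases (hreal (c + 1)).normSq hq with h0 | ⟨s, hs, h0⟩
    · exact h0
    · rw [hstep, sub_self, qNum_zero, mul_zero, Complex.ofReal_zero, zero_mul] at h0
      exact absurd (by exact_mod_cast h0.symm) hs.ne'
  have hdiag : ∀ i : ℕ, shapovalovTensor q a b ((T.f ^ i) w) ((T.f ^ i) w) =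
      ((xNormSq q c i * r : ℝ) : ℂ) := by
    intro i
    induction i with
    | zero => simp [hwr, xNormSq, qPoch, qFact]
    | succ i ih => rw [hstep, ih, xNormSq_succ]; push_cast; ring
  have hoff : ∀ i j : ℕ, i ≠ j → shapovalovTensor q a b ((T.f ^ i) w) ((T.f ^ j) w) = 0 := by
    intro i j hij
    have := shapovalovTensor_k hq a b ((T.f ^ i) w) ((T.f ^ j) w)
    rw [← hT, (hpow i).1, (hpow j).1, map_smul, map_smul, LinearMap.smul_apply, smul_eq_mul,
      smul_eq_mul, ← sub_eq_zero, ← sub_mul] at this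
    refine (mul_eq_zero.1 this).resolve_left fun h0 => hij ?_
    have h3 : q ^ (((c : ℝ) - 2 * i) / 4) = q ^ (((c : ℝ) - 2 * j) / 4) := by
      exact_mod_cast sub_eq_zero.1 h0
    have h4 := (Real.rpow_right_inj hq.1 hq.2.ne).1 h3
    have : (i : ℝ) = j := by linarith
    exact_mod_cast this
  have hsq : 0 < √r := Real.sqrt_pos.2 hr
  set Φ : Spin c →ₗ[ℂ] Spin a ⊗[ℂ] Spin b :=
    (Pi.basisFun ℂ (Fin (c + 1))).constr ℂ
      (fun i => (((√r)⁻¹ : ℝ) : ℂ) • (T.f ^ (i : ℕ)) w) with hΦ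
  have hΦx : ∀ i ≤ c + 1, Φ (xVec c i) = (((√r)⁻¹ : ℝ) : ℂ) • (T.f ^ i) w := by
    intro i hi
    rcases hi.lt_or_eq with h | rfl
    · have := xVec_coe c ⟨i, h⟩
      simp only at this
      rw [this, hΦ, Module.Basis.constr_basis]
    · rw [hlast, xVec_eq_zero (by omega), map_zero, smul_zero]
  refine ⟨Φ, ⟨?_, ?_, ?_⟩, ?_, ?_⟩
  · have : Φ ∘ₗ (irrep hq c).e = T.e ∘ₗ Φ := end_ext fun i hi => by
      simp only [LinearMap.comp_apply, irrep_e hq hi, map_smul, hΦx i (by omega),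
        hΦx (i - 1) (by omega), (hpow i).2]
      rw [smul_comm]
    exact LinearMap.congr_fun this
  · have : Φ ∘ₗ (irrep hq c).f = T.f ∘ₗ Φ := end_ext fun i hi => by
      simp only [LinearMap.comp_apply, irrep_f, map_smul, hΦx i (by omega),
        hΦx (i + 1) (by omega), pow_succ', Module.End.mul_apply]
    exact LinearMap.congr_fun this
  · have : Φ ∘ₗ (irrep hq c).k = T.k ∘ₗ Φ := end_ext fun i hi => by
      simp only [LinearMap.comp_apply, irrep_k, map_smul, hΦx i (by omega), (hpow i).1]
      rw [smul_comm]
    exact LinearMap.congr_fun this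
  · have : LinearMap.compl₁₂ (shapovalovTensor q a b) Φ Φ = shapovalov q c := by
      refine shapovalov_ext fun i hi j hj => ?_
      rw [LinearMap.compl₁₂_apply, hΦx i (by omega), hΦx j (by omega), map_smul, map_smul,
        LinearMap.smul_apply, shapovalov_xVec q c i j hi]
      by_cases hij : i = j
      · subst hij
        rw [if_pos rfl, hdiag, smul_eq_mul, smul_eq_mul, ← Complex.ofReal_mul,
          ← Complex.ofReal_mul]
        congr 1
        field_simp
        rw [Real.sq_sqrt hr.le]
        ring
      · rw [if_neg hij, hoff i j hij, smul_zero, smul_zero]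
    exact LinearMap.congr_fun₂ this
  · have g1 : 0 < √(xNormSq q a 0) := Real.sqrt_pos.2 (xNormSq_pos hq (by omega))
    have g2 : 0 < √(xNormSq q b l) := Real.sqrt_pos.2 (xNormSq_pos hq hb)
    have g3 : 0 < √(xNormSq q c 0) := Real.sqrt_pos.2 (xNormSq_pos hq (by omega))
    refine ⟨(√(xNormSq q c 0))⁻¹ * (√r)⁻¹ * ((√(xNormSq q a 0))⁻¹ * (√(xNormSq q b l))⁻¹) *
      (xNormSq q a 0 * xNormSq q b l), by positivity, ?_⟩
    rw [stdVec, stdVec, stdVec, map_smul, hΦx 0 (by omega), pow_zero, Module.End.one_apply,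
      TensorProduct.smul_tmul_smul, map_smul, map_smul, map_smul, LinearMap.smul_apply,
      LinearMap.smul_apply, hwVec_top q ha hb]
    simp only [smul_eq_mul]
    push_cast
    ring

/-- The embedding `V^j → V^{j₁} ⊗ V^{j₂}`, `e_m^j ↦ e_m^j(j₁, j₂)`, with `j₁ = a/2`, `j₂ = b/2`,
`j = c/2` (and zero if `V^j` does not occur in `V^{j₁} ⊗ V^{j₂}`). -/
def stdEmbedding {q : ℝ} (hq : q ∈ Set.Ioo (0 : ℝ) 1) (a b c : ℕ) :
    Spin c →ₗ[ℂ] Spin a ⊗[ℂ] Spin b :=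
  if h : Triad a b c then (exists_isStdEmbedding hq h).choose else 0

/-- The standard basis vector `e_m^{j₁₂,j}(j₁, j₂ | j₃)` of the copy of `V^j` inside
`V^{j₁₂} ⊗ V^{j₃} ⊆ (V^{j₁} ⊗ V^{j₂}) ⊗ V^{j₃}`, viewed in `V^{j₁} ⊗ (V^{j₂} ⊗ V^{j₃})`.
Here `j₁, j₂, j₃, j₁₂, j` are half of `a, b, d, c, n`, and `m = j - i`. -/
def leftBasis {q : ℝ} (hq : q ∈ Set.Ioo (0 : ℝ) 1) (a b d c n i : ℕ) :
    Spin a ⊗[ℂ] (Spin b ⊗[ℂ] Spin d) :=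
  TensorProduct.assoc ℂ (Spin a) (Spin b) (Spin d)
    (TensorProduct.map (stdEmbedding hq a b c) LinearMap.id (stdEmbedding hq c d n (stdVec q n i)))

/-- The standard basis vector `e_m^{j₂₃,j}(j₁ | j₂, j₃)` of the copy of `V^j` inside
`V^{j₁} ⊗ V^{j₂₃} ⊆ V^{j₁} ⊗ (V^{j₂} ⊗ V^{j₃})`.
Here `j₁, j₂, j₃, j₂₃, j` are half of `a, b, d, p, n`, and `m = j - i`. -/
def rightBasis {q : ℝ} (hq : q ∈ Set.Ioo (0 : ℝ) 1) (a b d p n i : ℕ) :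
    Spin a ⊗[ℂ] (Spin b ⊗[ℂ] Spin d) :=
  TensorProduct.map LinearMap.id (stdEmbedding hq b d p) (stdEmbedding hq a p n (stdVec q n i))

open Classical in
/-- The `q`-Racah coefficient `W^{j₂,j₃,j₂₃}_{j₁₂-j₁,j-j₁₂,j-j₁}(j)`, where
`j₁, j₂, j₃, j₁₂, j, j₂₃` are half of `a, b, d, c, n, p`: the coefficient of
`e_m^{j₂₃,j}(j₁ | j₂, j₃)` in the expansion
`e_m^{j₁₂,j}(j₁, j₂ | j₃) = ∑_{j₂₃} W_{j₂₃} e_m^{j₂₃,j}(j₁ | j₂, j₃)` (valid for all `m`), with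
`j₂₃` running over the spins such that `V^{j₂₃}` occurs in `V^{j₂} ⊗ V^{j₃}` and `V^j` occurs in
`V^{j₁} ⊗ V^{j₂₃}`. By complete reducibility the expansion exists; its coefficients are unique,
because the vectors on the right are linearly independent. -/
def racah {q : ℝ} (hq : q ∈ Set.Ioo (0 : ℝ) 1) (a b d c n p : ℕ) : ℂ :=
  if h : ∃ W : ℕ → ℂ, ∀ i ≤ n, leftBasis hq a b d c n i =
      ∑ p ∈ Finset.range (b + d + 1) with Triad b d p ∧ Triad a p n,
        W p • rightBasis hq a b d p n i
  then h.choose p else 0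

/-- The `q`-`6j` symbol `{ j₃ j₁ j₁₃ ; j₂ j j₁₂ }_q`, where the entries
`j₃, j₁, j₁₃` (upper row) and `j₂, j, j₁₂` (lower row) are half of `a, b, c` and `d, n, p`:
`(-1)^{j₁+j₂+j+j₃} ([2j₁₂+1]_q [2j₁₃+1]_q)^{-1/2} W^{j₁,j₂,j₁₂}_{j₁₃-j₃,j-j₁₃,j-j₃}(j)`.
It is used only where `(a,b,c)`, `(c,d,n)`, `(b,d,p)`, `(a,p,n)` satisfy the triangle condition;
then `a + b + d + n` is even. -/
def sixJ {q : ℝ} (hq : q ∈ Set.Ioo (0 : ℝ) 1) (a b c d n p : ℕ) : ℂ :=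
  (-1) ^ ((b + d + n + a) / 2) *
    (((qNum q ((p : ℝ) + 1) * qNum q ((c : ℝ) + 1)) ^ (-(1 : ℝ) / 2) : ℝ) : ℂ) *
    racah hq a b d c n p

/-- `c_j = j (j + 1)` for `j = n/2`. -/
def casimir (n : ℕ) : ℝ := (n : ℝ) / 2 * ((n : ℝ) / 2 + 1)

end QSixJ

end

/-!
Let `Ř` be the braiding of `V^{j₁}` past a tensor product, that is, the universal `R`-matrix
followed by the flip. Consider the intertwining map that recouples `V^{j₄} ⊗ V^{j₃}` to
`V^{j₁} ⊗ (V^{j₂} ⊗ V^{j₇})`, braids `V^{j₁}` past `V^{j₂} ⊗ V^{j₇}` and projects `V^{j₇} ⊗ V^{j₁}`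
to `V^{j₈}`. By Schur's lemma it maps the copy of `V^{j₉}` in `V^{j₄} ⊗ V^{j₃}` to that in
`V^{j₂} ⊗ V^{j₈}` by a scalar, which can be computed in two ways. Either `V^{j₂} ⊗ V^{j₇}` is
decomposed into the `V^{j₁₀}` and passed at once, the braiding being the scalar
`± q^{(c_{j₉} - c_{j₁} - c_{j₁₀})/2}` on each copy of `V^{j₉}`; or `V^{j₁}` is taken past `V^{j₂}`
and `V^{j₇} ⊆ V^{j₆} ⊗ V^{j₃}` one factor at a time (hexagon identity and naturality), which
produces the spins `j₁₀` of `V^{j₁} ⊗ V^{j₆}`. Rescaling the Racah coefficients to `6j` symbols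
turns the equality of the two scalars into the Yang–Baxter identity.
-/

noncomputable section

namespace QSixJ

/-! ### Intertwining operators -/

namespace UqRep

variable {q : ℝ} {U V W V' W' : Type*} [AddCommGroup U] [Module ℂ U] [AddCommGroup V] [Module ℂ V]
  [AddCommGroup W] [Module ℂ W] [AddCommGroup V'] [Module ℂ V'] [AddCommGroup W'] [Module ℂ W']

theorem map_k'_of_map_k {ρ : UqRep q V} {σ : UqRep q W} {Φ : V →ₗ[ℂ] W}
    (h : ∀ v, Φ (ρ.k v) = σ.k (Φ v)) (v : V) : Φ (ρ.k' v) = σ.k' (Φ v) := by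
  have hρ : ρ.k (ρ.k' v) = v := LinearMap.congr_fun ρ.k_mul_k' v
  have hσ : σ.k' (σ.k (Φ (ρ.k' v))) = Φ (ρ.k' v) := LinearMap.congr_fun σ.k'_mul_k _
  rw [← hσ, ← h, hρ]

namespace IsIntertwining

theorem map_k' {ρ : UqRep q V} {σ : UqRep q W} {Φ : V →ₗ[ℂ] W} (h : IsIntertwining ρ σ Φ) (v : V) :
    Φ (ρ.k' v) = σ.k' (Φ v) :=
  map_k'_of_map_k h.map_k v

theorem zero (ρ : UqRep q V) (σ : UqRep q W) : IsIntertwining ρ σ 0 :=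
  ⟨fun _ => (map_zero _).symm, fun _ => (map_zero _).symm, fun _ => (map_zero _).symm⟩

theorem id (ρ : UqRep q V) : IsIntertwining ρ ρ LinearMap.id :=
  ⟨fun _ => rfl, fun _ => rfl, fun _ => rfl⟩

theorem comp {ρ : UqRep q U} {σ : UqRep q V} {τ : UqRep q W} {Ψ : V →ₗ[ℂ] W} {Φ : U →ₗ[ℂ] V}
    (hΨ : IsIntertwining σ τ Ψ) (hΦ : IsIntertwining ρ σ Φ) : IsIntertwining ρ τ (Ψ ∘ₗ Φ) :=
  ⟨fun v => by simp [hΦ.map_e, hΨ.map_e], fun v => by simp [hΦ.map_f, hΨ.map_f],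
    fun v => by simp [hΦ.map_k, hΨ.map_k]⟩

theorem symm {ρ : UqRep q V} {σ : UqRep q W} {Φ : V ≃ₗ[ℂ] W}
    (h : IsIntertwining ρ σ Φ.toLinearMap) : IsIntertwining σ ρ Φ.symm.toLinearMap :=
  ⟨fun w => Φ.symm_apply_eq.2 (by simpa using (h.map_e (Φ.symm w)).symm),
    fun w => Φ.symm_apply_eq.2 (by simpa using (h.map_f (Φ.symm w)).symm),
    fun w => Φ.symm_apply_eq.2 (by simpa using (h.map_k (Φ.symm w)).symm)⟩

theorem map (hq : 0 < q) {ρ : UqRep q V} {ρ' : UqRep q V'} {σ : UqRep q W} {σ' : UqRep q W'}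
    {Φ : V →ₗ[ℂ] V'} {Ψ : W →ₗ[ℂ] W'} (hΦ : IsIntertwining ρ ρ' Φ) (hΨ : IsIntertwining σ σ' Ψ) :
    IsIntertwining (tensor hq ρ σ) (tensor hq ρ' σ') (TensorProduct.map Φ Ψ) := by
  refine ⟨fun v => ?_, fun v => ?_, fun v => ?_⟩ <;>
  induction v using TensorProduct.induction_on with
  | zero => simp only [map_zero]
  | add x y hx hy => simp only [map_add, hx, hy]
  | tmul x y =>
    simp [tensor, hΦ.map_e, hΦ.map_f, hΦ.map_k, hΦ.map_k', hΨ.map_e, hΨ.map_f, hΨ.map_k]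

theorem lTensor (hq : 0 < q) (ρ : UqRep q U) {σ : UqRep q V} {τ : UqRep q W} {Φ : V →ₗ[ℂ] W}
    (h : IsIntertwining σ τ Φ) :
    IsIntertwining (tensor hq ρ σ) (tensor hq ρ τ) (Φ.lTensor U) :=
  (IsIntertwining.id ρ).map hq h

theorem rTensor (hq : 0 < q) (ρ : UqRep q U) {σ : UqRep q V} {τ : UqRep q W} {Φ : V →ₗ[ℂ] W}
    (h : IsIntertwining σ τ Φ) :
    IsIntertwining (tensor hq σ ρ) (tensor hq τ ρ) (Φ.rTensor U) :=
  h.map hq (IsIntertwining.id ρ)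

theorem assoc (hq : 0 < q) (ρ : UqRep q U) (σ : UqRep q V) (τ : UqRep q W) :
    IsIntertwining (tensor hq (tensor hq ρ σ) τ) (tensor hq ρ (tensor hq σ τ))
      (TensorProduct.assoc ℂ U V W).toLinearMap := by
  refine ⟨fun v => ?_, fun v => ?_, fun v => ?_⟩ <;>
  induction v using TensorProduct.induction_on with
  | zero => simp only [map_zero]
  | add x y hx hy => simp only [map_add, hx, hy]
  | tmul x y =>
    induction x using TensorProduct.induction_on with
    | zero => simp only [TensorProduct.zero_tmul, map_zero]
    | add x x' hx hx' => simp only [map_add, TensorProduct.add_tmul, hx, hx']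
    | tmul x x' => simp [tensor, TensorProduct.add_tmul, TensorProduct.tmul_add, add_assoc]

end IsIntertwining

end UqRep

variable {q : ℝ} (hq : q ∈ Set.Ioo (0 : ℝ) 1)

/-! ### The irreducible modules and their Shapovalov forms -/

theorem irrep_e_xVec_zero (n : ℕ) : (irrep hq n).e (xVec n 0) = 0 := by
  rw [irrep_e hq (Nat.zero_le n), Nat.cast_zero, qNum_zero, zero_mul, Complex.ofReal_zero,
    zero_smul]

theorem xVec_eq_f_pow (n i : ℕ) : xVec n i = ((irrep hq n).f ^ i) (xVec n 0) := by
  induction i with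
  | zero => rfl
  | succ i ih => rw [pow_succ', Module.End.mul_apply, ← ih, irrep_f]

theorem spin_eq_sum_xVec {n : ℕ} (v : Spin n) : v = ∑ i : Fin (n + 1), v i • xVec n i := by
  ext l
  simp [xVec, Finset.sum_apply, Fin.val_inj]

theorem shapovalov_apply_xVec {n : ℕ} (v : Spin n) (i : Fin (n + 1)) :
    shapovalov q n v (xVec n i) = v i * ((xNormSq q n i : ℝ) : ℂ) := by
  conv_lhs => rw [spin_eq_sum_xVec v]
  simp only [map_sum, map_smul, LinearMap.sum_apply, LinearMap.smul_apply]
  rw [Finset.sum_eq_single_of_mem i (Finset.mem_univ i) fun j _ hj => ?_]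
  · rw [shapovalov_xVec _ _ _ _ (Nat.le_of_lt_succ i.2), if_pos rfl, smul_eq_mul]
  · rw [shapovalov_xVec _ _ _ _ (Nat.le_of_lt_succ j.2), if_neg (fun h => hj (Fin.ext h)),
      smul_zero]

theorem shapovalov_symm {n : ℕ} (v w : Spin n) : shapovalov q n v w = shapovalov q n w v := by
  have hflip : shapovalov q n = LinearMap.flip (shapovalov q n) := by
    refine shapovalov_ext fun i hi j hj => ?_
    rw [LinearMap.flip_apply, shapovalov_xVec _ _ _ _ hi, shapovalov_xVec _ _ _ _ hj]
    by_cases h : i = j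
    · rw [h]
    · rw [if_neg h, if_neg (Ne.symm h)]
  exact LinearMap.congr_fun₂ hflip v w

theorem shapovalovTensor_symm {a b : ℕ} (v w : Spin a ⊗[ℂ] Spin b) :
    shapovalovTensor q a b v w = shapovalovTensor q a b w v := by
  induction v using TensorProduct.induction_on with
  | zero => simp only [map_zero, LinearMap.zero_apply]
  | add x y hx hy => simp only [map_add, LinearMap.add_apply, hx, hy]
  | tmul x y =>
    induction w using TensorProduct.induction_on with
    | zero => simp only [map_zero, LinearMap.zero_apply]
    | add x y hx hy => simp only [map_add, LinearMap.add_apply, hx, hy]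
    | tmul x' y' =>
      rw [shapovalovTensor_tmul, shapovalovTensor_tmul, shapovalov_symm, shapovalov_symm y]

theorem shapovalov_f {n : ℕ} (v w : Spin n) :
    shapovalov q n ((irrep hq n).f v) w = shapovalov q n v ((irrep hq n).e w) := by
  rw [shapovalov_symm, ← shapovalov_e, shapovalov_symm]

theorem shapovalovTensor_f {a b : ℕ} (v w : Spin a ⊗[ℂ] Spin b) :
    shapovalovTensor q a b ((UqRep.tensor hq.1 (irrep hq a) (irrep hq b)).f v) w =
      shapovalovTensor q a b v ((UqRep.tensor hq.1 (irrep hq a) (irrep hq b)).e w) := by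
  rw [shapovalovTensor_symm, ← shapovalovTensor_e, shapovalovTensor_symm]

theorem ofReal_xNormSq_ne_zero (hq : q ∈ Set.Ioo (0 : ℝ) 1) {n : ℕ} (i : Fin (n + 1)) :
    ((xNormSq q n i : ℝ) : ℂ) ≠ 0 :=
  Complex.ofReal_ne_zero.2 (xNormSq_pos hq (Nat.le_of_lt_succ i.2)).ne'

theorem ext_shapovalov_left (hq : q ∈ Set.Ioo (0 : ℝ) 1) {n : ℕ} {v w : Spin n}
    (h : ∀ u, shapovalov q n v u = shapovalov q n w u) : v = w := by
  ext i
  have hi := h (xVec n i)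
  rw [shapovalov_apply_xVec, shapovalov_apply_xVec] at hi
  exact mul_right_cancel₀ (ofReal_xNormSq_ne_zero hq i) hi

theorem eq_smul_xVec_zero_of_e_eq_zero {n : ℕ} {v : Spin n} (h : (irrep hq n).e v = 0) :
    v = v 0 • xVec n 0 := by
  have coord_eq_zero : ∀ i : Fin (n + 1), i ≠ 0 → v i = 0 := by
    intro i hi
    obtain ⟨j, rfl⟩ := Fin.exists_succ_eq.2 hi
    have hadj := shapovalov_e hq n v (xVec n j)
    rw [h, irrep_f, map_zero, LinearMap.zero_apply, ← Fin.val_succ, shapovalov_apply_xVec] at hadj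
    exact (mul_eq_zero.1 hadj.symm).resolve_right (ofReal_xNormSq_ne_zero hq j.succ)
  conv_lhs => rw [spin_eq_sum_xVec v]
  exact Finset.sum_eq_single_of_mem 0 (Finset.mem_univ 0) fun i _ hi => by
    rw [coord_eq_zero i hi, zero_smul]

/-! ### Schur's lemma -/

namespace UqRep.IsIntertwining

variable {hq}

theorem apply_xVec {n : ℕ} {W : Type*} [AddCommGroup W] [Module ℂ W] {σ : UqRep q W}
    {Ψ : Spin n →ₗ[ℂ] W} (h : IsIntertwining (irrep hq n) σ Ψ) (i : ℕ) :
    Ψ (xVec n i) = (σ.f ^ i) (Ψ (xVec n 0)) := by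
  induction i with
  | zero => rfl
  | succ i ih => rw [pow_succ', Module.End.mul_apply, ← ih, ← h.map_f, irrep_f]

theorem apply_xVec_zero {n c : ℕ} {Ψ : Spin n →ₗ[ℂ] Spin c}
    (h : IsIntertwining (irrep hq n) (irrep hq c) Ψ) :
    Ψ (xVec n 0) = Ψ (xVec n 0) 0 • xVec c 0 := by
  refine eq_smul_xVec_zero_of_e_eq_zero hq ?_
  rw [← h.map_e, irrep_e_xVec_zero, map_zero]

theorem exists_eq_smul_id {n : ℕ} {Ψ : Spin n →ₗ[ℂ] Spin n}
    (h : IsIntertwining (irrep hq n) (irrep hq n) Ψ) : ∃ t : ℂ, Ψ = t • LinearMap.id := by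
  refine ⟨Ψ (xVec n 0) 0, end_ext fun i _ => ?_⟩
  rw [h.apply_xVec, h.apply_xVec_zero, map_smul, ← xVec_eq_f_pow]
  simp [xVec]

theorem eq_zero_of_ne {n c : ℕ} (hnc : n ≠ c) {Ψ : Spin n →ₗ[ℂ] Spin c}
    (h : IsIntertwining (irrep hq n) (irrep hq c) Ψ) : Ψ = 0 := by
  have weights_ne : ((q ^ (((n : ℝ) - 2 * (0 : ℕ)) / 4) : ℝ) : ℂ) -
      ((q ^ (((c : ℝ) - 2 * (0 : ℕ)) / 4) : ℝ) : ℂ) ≠ 0 := by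
    rw [sub_ne_zero, Ne, Complex.ofReal_inj, Real.rpow_right_inj hq.1 hq.2.ne]
    intro heq
    exact hnc (by exact_mod_cast (by linarith : (n : ℝ) = c))
  have hk : Ψ ((irrep hq n).k (xVec n 0)) 0 = (irrep hq c).k (Ψ (xVec n 0)) 0 := by rw [h.map_k]
  rw [h.apply_xVec_zero, irrep_k, map_smul, map_smul, irrep_k, h.apply_xVec_zero] at hk
  simp only [Pi.smul_apply, smul_eq_mul, xVec, Fin.val_zero, if_true, mul_one] at hk
  have hzero : Ψ (xVec n 0) 0 = 0 :=
    (mul_eq_zero.1 (by linear_combination hk)).resolve_left weights_ne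
  refine end_ext fun i _ => ?_
  rw [h.apply_xVec, h.apply_xVec_zero, hzero, zero_smul, map_zero, LinearMap.zero_apply]

end UqRep.IsIntertwining

/-! ### The decomposition of a tensor product -/

theorem isStdEmbedding_stdEmbedding {a b c : ℕ} (h : Triad a b c) :
    IsStdEmbedding hq a b c (stdEmbedding hq a b c) := by
  rw [stdEmbedding, dif_pos h]
  exact (exists_isStdEmbedding hq h).choose_spec

theorem stdEmbedding_of_not_triad {a b c : ℕ} (h : ¬ Triad a b c) : stdEmbedding hq a b c = 0 :=
  dif_neg h

theorem isIntertwining_stdEmbedding (a b c : ℕ) :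
    UqRep.IsIntertwining (irrep hq c) (UqRep.tensor hq.1 (irrep hq a) (irrep hq b))
      (stdEmbedding hq a b c) := by
  by_cases h : Triad a b c
  · exact (isStdEmbedding_stdEmbedding hq h).intertwining
  · rw [stdEmbedding_of_not_triad hq h]
    exact UqRep.IsIntertwining.zero _ _

/-- The projection `V^{j₁} ⊗ V^{j₂} → V^j`, adjoint to the standard embedding with respect to the
Shapovalov forms; it is zero if `(j₁, j₂, j)` is not a triad. -/
def stdProj (a b c : ℕ) : Spin a ⊗[ℂ] Spin b →ₗ[ℂ] Spin c :=
  LinearMap.pi fun i : Fin (c + 1) => ((xNormSq q c i : ℝ) : ℂ)⁻¹ •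
    (shapovalovTensor q a b).flip (stdEmbedding hq a b c (xVec c i))

theorem shapovalov_stdProj {a b c : ℕ} (w : Spin a ⊗[ℂ] Spin b) (v : Spin c) :
    shapovalov q c (stdProj hq a b c w) v = shapovalovTensor q a b w (stdEmbedding hq a b c v) := by
  rw [spin_eq_sum_xVec v]
  simp only [map_sum, map_smul]
  refine Finset.sum_congr rfl fun i _ => congrArg _ ?_
  rw [shapovalov_apply_xVec, stdProj, LinearMap.pi_apply, LinearMap.smul_apply, smul_eq_mul,
    LinearMap.BilinForm.flip_apply, mul_comm, mul_inv_cancel_left₀ (ofReal_xNormSq_ne_zero hq i)]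

theorem isIntertwining_stdProj (a b c : ℕ) :
    UqRep.IsIntertwining (UqRep.tensor hq.1 (irrep hq a) (irrep hq b)) (irrep hq c)
      (stdProj hq a b c) := by
  have h := isIntertwining_stdEmbedding hq a b c
  refine ⟨fun v => ?_, fun v => ?_, fun v => ?_⟩ <;>
  refine ext_shapovalov_left hq fun u => ?_
  · rw [shapovalov_stdProj, shapovalovTensor_e, shapovalov_e, shapovalov_stdProj, h.map_f]
  · rw [shapovalov_stdProj, shapovalovTensor_f, shapovalov_f, shapovalov_stdProj, h.map_e]
  · rw [shapovalov_stdProj, shapovalovTensor_k, shapovalov_k, shapovalov_stdProj, h.map_k]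

theorem stdProj_comp_stdEmbedding {a b c : ℕ} (h : Triad a b c) :
    stdProj hq a b c ∘ₗ stdEmbedding hq a b c = LinearMap.id := by
  refine LinearMap.ext fun v => ext_shapovalov_left hq fun u => ?_
  rw [LinearMap.comp_apply, shapovalov_stdProj, (isStdEmbedding_stdEmbedding hq h).isometry,
    LinearMap.id_apply]

theorem stdProj_comp_stdEmbedding_of_ne {a b c d : ℕ} (h : c ≠ d) :
    stdProj hq a b d ∘ₗ stdEmbedding hq a b c = 0 :=
  ((isIntertwining_stdProj hq a b d).comp (isIntertwining_stdEmbedding hq a b c)).eq_zero_of_ne h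

theorem Triad.swap {a b c : ℕ} (h : Triad a b c) : Triad b a c :=
  ⟨h.2.1, h.1, by rw [add_comm]; exact h.2.2.1, by rw [add_comm b]; exact h.2.2.2⟩

theorem Triad.rotate {a b c : ℕ} (h : Triad a b c) : Triad c a b :=
  ⟨h.2.2.1, by rw [add_comm]; exact h.1, by rw [add_comm]; exact h.2.1,
    by rw [add_assoc, add_comm]; exact h.2.2.2⟩

theorem Triad.mem_filter_range {a b c : ℕ} (h : Triad a b c) :
    c ∈ (Finset.range (a + b + 1)).filter (Triad a b) :=
  Finset.mem_filter.2 ⟨Finset.mem_range.2 (Nat.lt_succ_of_le h.2.2.1), h⟩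

theorem sum_filter_triad {M : Type*} [AddCommMonoid M] (a b : ℕ) (g : ℕ → M) :
    ∑ c ∈ Finset.range (a + b + 1) with Triad a b c, g c =
      ∑ l ∈ Finset.range (min a b + 1), g (a + b - 2 * l) := by
  refine Finset.sum_nbij' (fun c => (a + b - c) / 2) (fun l => a + b - 2 * l) ?_ ?_ ?_ ?_ ?_ <;>
  intro c hc <;>
  simp only [Finset.mem_range, Finset.mem_filter, Triad, Nat.even_iff] at hc ⊢
  · omega
  · omega
  · omega
  · omega
  · congr 1
    omega

theorem sum_range_sub_two_mul_add_one {m s : ℕ} (h : 2 * m ≤ s) :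
    ∑ l ∈ Finset.range (m + 1), (s - 2 * l + 1) = (m + 1) * (s - m + 1) := by
  induction m with
  | zero => simp
  | succ m ih =>
    rw [Finset.sum_range_succ, ih (by omega)]
    obtain ⟨t, rfl⟩ := Nat.exists_eq_add_of_le h
    rw [show 2 * (m + 1) + t - m = m + t + 2 by omega,
      show 2 * (m + 1) + t - 2 * (m + 1) = t by omega,
      show 2 * (m + 1) + t - (m + 1) = m + t + 1 by omega]
    ring

theorem sum_triad_finrank (a b : ℕ) :
    ∑ c ∈ Finset.range (a + b + 1) with Triad a b c, (c + 1) = (a + 1) * (b + 1) := by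
  rw [sum_filter_triad, sum_range_sub_two_mul_add_one (by omega)]
  rcases le_total a b with h | h
  · rw [min_eq_left h, Nat.add_sub_cancel_left]
  · rw [min_eq_right h, Nat.add_sub_cancel, mul_comm]

theorem eq_one_of_isIdempotentElem_of_trace_eq_finrank {K V : Type*} [Field K] [CharZero K]
    [AddCommGroup V] [Module K V] [FiniteDimensional K V] {P : Module.End K V}
    (h : IsIdempotentElem P) (ht : LinearMap.trace K V P = Module.finrank K V) : P = 1 := by
  refine (sub_eq_zero.1 (LinearMap.IsIdempotentElem.eq_zero_of_trace_eq_zero h.one_sub ?_)).symm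
  rw [map_sub, LinearMap.trace_one, ht, sub_self]

theorem isIdempotentElem_sum_stdEmbedding_comp_stdProj (a b : ℕ) :
    IsIdempotentElem (M := Module.End ℂ (Spin a ⊗[ℂ] Spin b))
      (∑ c ∈ Finset.range (a + b + 1) with Triad a b c,
        stdEmbedding hq a b c ∘ₗ stdProj hq a b c) := by
  rw [IsIdempotentElem, Finset.sum_mul_sum]
  refine Finset.sum_congr rfl fun c hc => ?_
  rw [Finset.sum_eq_single_of_mem c hc fun d _ hd => ?_] <;>
    rw [Module.End.mul_eq_comp, LinearMap.comp_assoc, ← LinearMap.comp_assoc _ _ (stdProj hq a b c)]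
  · rw [stdProj_comp_stdEmbedding hq (Finset.mem_filter.1 hc).2, LinearMap.id_comp]
  · rw [stdProj_comp_stdEmbedding_of_ne hq hd, LinearMap.zero_comp, LinearMap.comp_zero]

theorem sum_stdEmbedding_comp_stdProj (a b : ℕ) :
    ∑ c ∈ Finset.range (a + b + 1) with Triad a b c,
      stdEmbedding hq a b c ∘ₗ stdProj hq a b c = LinearMap.id := by
  refine eq_one_of_isIdempotentElem_of_trace_eq_finrank
    (isIdempotentElem_sum_stdEmbedding_comp_stdProj hq a b) ?_
  calc LinearMap.trace ℂ _ (∑ c ∈ Finset.range (a + b + 1) with Triad a b c,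
        stdEmbedding hq a b c ∘ₗ stdProj hq a b c)
      = ∑ c ∈ Finset.range (a + b + 1) with Triad a b c, ((c + 1 : ℕ) : ℂ) := by
        rw [map_sum]
        refine Finset.sum_congr rfl fun c hc => ?_
        rw [LinearMap.trace_comp_comm', stdProj_comp_stdEmbedding hq (Finset.mem_filter.1 hc).2,
          LinearMap.trace_id, Module.finrank_fin_fun]
    _ = Module.finrank ℂ (Spin a ⊗[ℂ] Spin b) := by
        rw [← Nat.cast_sum, sum_triad_finrank, Module.finrank_tensorProduct,
          Module.finrank_fin_fun, Module.finrank_fin_fun]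

theorem UqRep.IsIntertwining.exists_eq_smul_stdEmbedding {hq : q ∈ Set.Ioo (0 : ℝ) 1} {a b n : ℕ}
    {Ψ : Spin n →ₗ[ℂ] Spin a ⊗[ℂ] Spin b}
    (h : UqRep.IsIntertwining (irrep hq n) (UqRep.tensor hq.1 (irrep hq a) (irrep hq b)) Ψ) :
    ∃ t : ℂ, Ψ = t • stdEmbedding hq a b n := by
  obtain ⟨t, ht⟩ := ((isIntertwining_stdProj hq a b n).comp h).exists_eq_smul_id
  have proj_eq_zero : ∀ c, c ≠ n → stdProj hq a b c ∘ₗ Ψ = 0 := fun c hc =>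
    ((isIntertwining_stdProj hq a b c).comp h).eq_zero_of_ne hc.symm
  have expand : Ψ = ∑ c ∈ Finset.range (a + b + 1) with Triad a b c,
      stdEmbedding hq a b c ∘ₗ stdProj hq a b c ∘ₗ Ψ := by
    conv_lhs => rw [← LinearMap.id_comp Ψ, ← sum_stdEmbedding_comp_stdProj hq a b]
    exact LinearMap.ext fun v => by simp
  refine ⟨t, ?_⟩
  rw [expand, Finset.sum_eq_single n]
  · rw [ht, LinearMap.comp_smul, LinearMap.comp_id]
  · intro c _ hc
    rw [proj_eq_zero c hc, LinearMap.comp_zero]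
  · intro hn
    rw [stdEmbedding_of_not_triad hq fun h => hn h.mem_filter_range, LinearMap.zero_comp]

/-! ### The coefficients of the universal `R`-matrix -/

theorem qNum_denom_ne_zero (hq : q ∈ Set.Ioo (0 : ℝ) 1) :
    q ^ ((1 : ℝ) / 2) - q ^ (-(1 : ℝ) / 2) ≠ 0 :=
  sub_ne_zero.2 (Real.rpow_lt_rpow_of_exponent_gt hq.1 hq.2 (by norm_num)).ne

theorem qNum_mul_sub_qNum_mul (hq : q ∈ Set.Ioo (0 : ℝ) 1) (x y z : ℝ) :
    qNum q x * qNum q y - qNum q (x - z) * qNum q (y + z) = qNum q z * qNum q (y - x + z) := by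
  have hq0 := hq.1
  have hd := qNum_denom_ne_zero hq
  have hX : q ^ (x / 2) ≠ 0 := (Real.rpow_pos_of_pos hq0 _).ne'
  have hY : q ^ (y / 2) ≠ 0 := (Real.rpow_pos_of_pos hq0 _).ne'
  have hZ : q ^ (z / 2) ≠ 0 := (Real.rpow_pos_of_pos hq0 _).ne'
  simp only [qNum, neg_div, add_div, sub_div, Real.rpow_neg hq0.le, Real.rpow_add hq0,
    Real.rpow_sub hq0] at hd ⊢
  field_simp
  ring

/-- The product `[i]_q ⋯ [i-r+1]_q [a-i+1]_q ⋯ [a-i+r]_q / [r]_q!`, the coefficient by which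
`e^r / [r]_q!` maps `x_{a-2i}` to `x_{a-2i+2r}`. -/
def braidProd (q : ℝ) (a i r : ℕ) : ℝ :=
  (∏ s ∈ Finset.range r, qNum q ((i : ℝ) - s)) * qPoch q ((a : ℝ) - i + 1) r / qFact q r

/-- The coefficient of the `r`-th term of the universal `R`-matrix on `x_{a-2i} ∈ V^{a/2}`. -/
def braidCoeff (q : ℝ) (a i r : ℕ) : ℝ :=
  (q ^ ((1 : ℝ) / 2) - q ^ (-(1 : ℝ) / 2)) ^ r *
    q ^ ((r : ℝ) * (2 * i - r - 1 - a) / 4) * braidProd q a i r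

theorem qFact_succ (q : ℝ) (r : ℕ) : qFact q (r + 1) = qFact q r * qNum q (r + 1) :=
  Finset.prod_range_succ _ _

theorem qFact_ne_zero (hq : q ∈ Set.Ioo (0 : ℝ) 1) (r : ℕ) : qFact q r ≠ 0 :=
  Finset.prod_ne_zero_iff.2 fun _ _ => (qNum_pos hq (by positivity)).ne'

theorem braidProd_succ_succ (hq : q ∈ Set.Ioo (0 : ℝ) 1) (a i r : ℕ) :
    braidProd q a (i + 1) (r + 1) =
      braidProd q a i (r + 1) + braidProd q a i r * qNum q ((a : ℝ) - 2 * i + r) := by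
  have prod_shift : ∏ s ∈ Finset.range (r + 1), qNum q (((i + 1 : ℕ) : ℝ) - s) =
      (∏ s ∈ Finset.range r, qNum q ((i : ℝ) - s)) * qNum q ((i : ℝ) + 1) := by
    rw [Finset.prod_range_succ']
    push_cast
    simp only [add_sub_add_right_eq_sub, sub_zero]
  have qPoch_shift : qPoch q ((a : ℝ) - ((i + 1 : ℕ) : ℝ) + 1) (r + 1) =
      qPoch q ((a : ℝ) - i + 1) r * qNum q ((a : ℝ) - i) := by
    rw [qPoch, Finset.prod_range_succ', qPoch]
    push_cast
    congr 1
    · exact Finset.prod_congr rfl fun s _ => by ring_nf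
    · ring_nf
  have qPoch_succ : qPoch q ((a : ℝ) - i + 1) (r + 1) =
      qPoch q ((a : ℝ) - i + 1) r * qNum q ((a : ℝ) - i + 1 + r) := Finset.prod_range_succ _ _
  have exchange := qNum_mul_sub_qNum_mul hq ((i : ℝ) + 1) ((a : ℝ) - i) ((r : ℝ) + 1)
  rw [show (i : ℝ) + 1 - (r + 1) = i - r by ring,
    show (a : ℝ) - i + (r + 1) = a - i + 1 + r by ring,
    show (a : ℝ) - i - (i + 1) + (r + 1) = a - 2 * i + r by ring] at exchange
  have hr : qNum q ((r : ℝ) + 1) ≠ 0 := (qNum_pos hq (by positivity)).ne'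
  have hf := qFact_ne_zero hq r
  rw [braidProd, braidProd, braidProd, prod_shift, qPoch_shift, qPoch_succ, qFact_succ,
    Finset.prod_range_succ]
  generalize qNum q ((a : ℝ) - 2 * i + r) = N at *
  field_simp
  linear_combination (∏ s ∈ Finset.range r, qNum q ((i : ℝ) - s)) *
    qPoch q ((a : ℝ) - i + 1) r * exchange

theorem braidCoeff_zero (q : ℝ) (a i : ℕ) : braidCoeff q a i 0 = 1 := by
  simp [braidCoeff, braidProd, qPoch, qFact]

theorem braidCoeff_eq_zero {a i r : ℕ} (h : i < r) : braidCoeff q a i r = 0 := by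
  have prod_eq_zero : ∏ s ∈ Finset.range r, qNum q ((i : ℝ) - s) = 0 :=
    Finset.prod_eq_zero (Finset.mem_range.2 h) (by rw [sub_self, qNum_zero])
  rw [braidCoeff, braidProd, prod_eq_zero, zero_mul, zero_div, mul_zero]

theorem braidCoeff_succ_left_eq_zero (a r : ℕ) : braidCoeff q a (a + 1) (r + 1) = 0 := by
  have qPoch_eq_zero : qPoch q ((a : ℝ) - ((a + 1 : ℕ) : ℝ) + 1) (r + 1) = 0 :=
    Finset.prod_eq_zero (Finset.mem_range.2 (Nat.succ_pos r))
      (by push_cast; rw [show (a : ℝ) - (a + 1) + 1 + 0 = 0 by ring, qNum_zero])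
  rw [braidCoeff, braidProd, qPoch_eq_zero, mul_zero, zero_div, mul_zero]

theorem braidCoeff_succ_succ (hq : q ∈ Set.Ioo (0 : ℝ) 1) (a i r : ℕ) :
    braidCoeff q a (i + 1) (r + 1) = q ^ (((r : ℝ) + 1) / 2) * braidCoeff q a i (r + 1) +
      braidCoeff q a i r * (q ^ (((a : ℝ) - 2 * i + 2 * r) / 4) -
        q ^ (-((a : ℝ) - 2 * i) / 4 + (2 * i - r - a) / 2)) := by
  have hq0 := hq.1
  set u := q ^ (((r + 1 : ℕ) : ℝ) * (2 * ((i + 1 : ℕ) : ℝ) - ((r + 1 : ℕ) : ℝ) - 1 - a) / 4) with hu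
  have power_succ : q ^ (((r : ℝ) + 1) / 2) *
      q ^ (((r + 1 : ℕ) : ℝ) * (2 * (i : ℝ) - ((r + 1 : ℕ) : ℝ) - 1 - a) / 4) = u := by
    rw [hu, ← Real.rpow_add hq0]
    push_cast
    ring_nf
  have power_sub : q ^ ((r : ℝ) * (2 * i - r - 1 - a) / 4) *
      (q ^ (((a : ℝ) - 2 * i + 2 * r) / 4) - q ^ (-((a : ℝ) - 2 * i) / 4 + (2 * i - r - a) / 2)) =
      u * (q ^ ((1 : ℝ) / 2) - q ^ (-(1 : ℝ) / 2)) * qNum q ((a : ℝ) - 2 * i + r) := by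
    rw [qNum, mul_assoc, mul_div_cancel₀ _ (qNum_denom_ne_zero hq), mul_sub (q ^ _), mul_sub u, hu,
      ← Real.rpow_add hq0, ← Real.rpow_add hq0, ← Real.rpow_add hq0, ← Real.rpow_add hq0]
    push_cast
    ring_nf
  rw [braidCoeff, ← hu, braidProd_succ_succ hq, braidCoeff, braidCoeff]
  linear_combination (-(q ^ ((1 : ℝ) / 2) - q ^ (-(1 : ℝ) / 2)) ^ (r + 1) *
    braidProd q a i (r + 1)) * power_succ -
    (q ^ ((1 : ℝ) / 2) - q ^ (-(1 : ℝ) / 2)) ^ r * braidProd q a i r * power_sub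

/-! ### The braiding -/

section

variable {R A : Type*} [CommSemiring R] [Semiring A] [Algebra R A] {c : R} {x y : A}

theorem pow_mul_of_mul_eq_smul (h : x * y = c • (y * x)) (m : ℕ) :
    x ^ m * y = c ^ m • (y * x ^ m) := by
  induction m with
  | zero => simp
  | succ m ih =>
    rw [pow_succ', mul_assoc, ih, mul_smul_comm, ← mul_assoc, h, smul_mul_assoc, smul_smul,
      mul_assoc, pow_succ]

theorem mul_pow_of_mul_eq_smul (h : x * y = c • (y * x)) (m : ℕ) :
    x * y ^ m = c ^ m • (y ^ m * x) := by
  induction m with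
  | zero => simp
  | succ m ih =>
    rw [pow_succ, ← mul_assoc, ih, smul_mul_assoc, mul_assoc, h, mul_smul_comm, smul_smul,
      ← mul_assoc, pow_succ]

end

section

variable {W W' : Type*} [AddCommGroup W] [Module ℂ W] [AddCommGroup W'] [Module ℂ W']

namespace UqRep

variable {hq}

theorem k_pow_mul_f (hq : 0 < q) (σ : UqRep q W) (m : ℕ) :
    σ.k ^ m * σ.f = ((q ^ (-(m : ℝ) / 2) : ℝ) : ℂ) • (σ.f * σ.k ^ m) := by
  rw [pow_mul_of_mul_eq_smul σ.k_mul_f, ← Complex.ofReal_pow, ← Real.rpow_mul_natCast hq.le]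
  ring_nf

theorem k_pow_mul_e (hq : 0 < q) (σ : UqRep q W) (m : ℕ) :
    σ.k ^ m * σ.e = ((q ^ ((m : ℝ) / 2) : ℝ) : ℂ) • (σ.e * σ.k ^ m) := by
  rw [pow_mul_of_mul_eq_smul σ.k_mul_e, ← Complex.ofReal_pow, ← Real.rpow_mul_natCast hq.le]
  ring_nf

theorem k'_pow_mul_f (hq : 0 < q) (σ : UqRep q W) (m : ℕ) :
    σ.k' ^ m * σ.f = ((q ^ ((m : ℝ) / 2) : ℝ) : ℂ) • (σ.f * σ.k' ^ m) := by
  rw [pow_mul_of_mul_eq_smul (σ.k'_mul_f hq), ← Complex.ofReal_pow, ← Real.rpow_mul_natCast hq.le]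
  ring_nf

theorem k'_mul_f_pow (hq : 0 < q) (σ : UqRep q W) (r : ℕ) :
    σ.k' * σ.f ^ r = ((q ^ ((r : ℝ) / 2) : ℝ) : ℂ) • (σ.f ^ r * σ.k') := by
  rw [mul_pow_of_mul_eq_smul (σ.k'_mul_f hq), ← Complex.ofReal_pow, ← Real.rpow_mul_natCast hq.le]
  ring_nf

theorem k_pow_mul_k'_pow_mul_f (hq : 0 < q) (σ : UqRep q W) (a m : ℕ) :
    σ.k ^ a * σ.k' ^ m * σ.f =
      ((q ^ (((m : ℝ) - a) / 2) : ℝ) : ℂ) • (σ.f * (σ.k ^ a * σ.k' ^ m)) := by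
  rw [mul_assoc, σ.k'_pow_mul_f hq, mul_smul_comm, ← mul_assoc, σ.k_pow_mul_f hq, smul_mul_assoc,
    smul_smul, mul_assoc, ← Complex.ofReal_mul, ← Real.rpow_add hq]
  ring_nf

theorem k'_mul_k_pow_mul_k'_pow (σ : UqRep q W) (a m : ℕ) :
    σ.k' * (σ.k ^ a * σ.k' ^ m) = σ.k ^ a * σ.k' ^ (m + 1) := by
  have hcomm : Commute σ.k σ.k' := σ.k_mul_k'.trans σ.k'_mul_k.symm
  rw [← mul_assoc, ← (hcomm.pow_left a).eq, mul_assoc, ← pow_succ']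

theorem tensor_f_xVec_tmul (a i : ℕ) (σ : UqRep q W) (w : W) :
    (tensor hq.1 (irrep hq a) σ).f (xVec a i ⊗ₜ w) =
      xVec a (i + 1) ⊗ₜ σ.k w + ((q ^ (-((a : ℝ) - 2 * i) / 4) : ℝ) : ℂ) • (xVec a i ⊗ₜ σ.f w) := by
  simp only [tensor, LinearMap.add_apply, TensorProduct.map_tmul, irrep_f, irrep_k',
    ← TensorProduct.smul_tmul']

theorem tensor_f_tmul_xVec (a p : ℕ) (σ : UqRep q W) (w : W) :
    (tensor hq.1 σ (irrep hq a)).f (w ⊗ₜ xVec a p) =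
      ((q ^ (((a : ℝ) - 2 * p) / 4) : ℝ) : ℂ) • (σ.f w ⊗ₜ xVec a p) +
        σ.k' w ⊗ₜ xVec a (p + 1) := by
  simp only [tensor, LinearMap.add_apply, TensorProduct.map_tmul, irrep_f, irrep_k,
    TensorProduct.tmul_smul]

end UqRep

theorem spin_tensor_ext {M : Type*} [AddCommGroup M] [Module ℂ M] {a : ℕ}
    {A B : Spin a ⊗[ℂ] W →ₗ[ℂ] M} (h : ∀ i ≤ a, ∀ w, A (xVec a i ⊗ₜ w) = B (xVec a i ⊗ₜ w)) :
    A = B :=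
  TensorProduct.ext (end_ext fun i hi => LinearMap.ext fun w => h i hi w)

theorem ext_of_map_f {M : Type*} [AddCommGroup M] [Module ℂ M] {a : ℕ} (σ : UqRep q W)
    {A B : Spin a ⊗[ℂ] W →ₗ[ℂ] M} (h0 : ∀ w, A (xVec a 0 ⊗ₜ w) = B (xVec a 0 ⊗ₜ w))
    (hf : ∀ v, A v = B v → A ((UqRep.tensor hq.1 (irrep hq a) σ).f v) =
      B ((UqRep.tensor hq.1 (irrep hq a) σ).f v)) : A = B := by
  have eq_on_xVec : ∀ i w, A (xVec a i ⊗ₜ w) = B (xVec a i ⊗ₜ w) := by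
    intro i
    induction i with
    | zero => exact h0
    | succ i ih =>
      intro w
      have hstep := hf _ (ih (σ.k' w))
      have hk : σ.k (σ.k' w) = w := LinearMap.congr_fun σ.k_mul_k' w
      rwa [UqRep.tensor_f_xVec_tmul, hk, map_add, map_add, map_smul, map_smul, ih,
        add_left_inj] at hstep
  exact spin_tensor_ext fun i _ => eq_on_xVec i

/-- The map `w ↦ f^r q^{(a-m)h/4} w ⊗ x_{a-2p}`, which occurs in the terms of the braiding. -/
def braidTerm (a : ℕ) (σ : UqRep q W) (m p r : ℕ) : W →ₗ[ℂ] W ⊗[ℂ] Spin a :=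
  (TensorProduct.mk ℂ W (Spin a)).flip (xVec a p) ∘ₗ (σ.f ^ r * (σ.k ^ a * σ.k' ^ m))

theorem braidTerm_apply (a : ℕ) (σ : UqRep q W) (m p r : ℕ) (w : W) :
    braidTerm a σ m p r w = (σ.f ^ r * (σ.k ^ a * σ.k' ^ m)) w ⊗ₜ xVec a p :=
  rfl

theorem braidTerm_k (a : ℕ) (σ : UqRep q W) (m p r : ℕ) (w : W) :
    braidTerm a σ (m + 1) p r (σ.k w) = braidTerm a σ m p r w := by
  rw [braidTerm_apply, braidTerm_apply, ← Module.End.mul_apply, pow_succ, mul_assoc, mul_assoc,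
    mul_assoc, σ.k'_mul_k, mul_one]

theorem braidTerm_f (hq : 0 < q) (a : ℕ) (σ : UqRep q W) (m p r : ℕ) (w : W) :
    braidTerm a σ m p r (σ.f w) =
      ((q ^ (((m : ℝ) - a) / 2) : ℝ) : ℂ) • braidTerm a σ m p (r + 1) w := by
  rw [braidTerm_apply, braidTerm_apply, ← Module.End.mul_apply, mul_assoc,
    σ.k_pow_mul_k'_pow_mul_f hq, mul_smul_comm, ← mul_assoc, ← pow_succ, LinearMap.smul_apply,
    TensorProduct.smul_tmul']

theorem tensor_f_braidTerm (a : ℕ) (σ : UqRep q W) (m p r : ℕ) (w : W) :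
    (UqRep.tensor hq.1 σ (irrep hq a)).f (braidTerm a σ m p r w) =
      ((q ^ (((a : ℝ) - 2 * p) / 4) : ℝ) : ℂ) • braidTerm a σ m p (r + 1) w +
        ((q ^ ((r : ℝ) / 2) : ℝ) : ℂ) • braidTerm a σ (m + 1) (p + 1) r w := by
  rw [braidTerm_apply, UqRep.tensor_f_tmul_xVec, ← Module.End.mul_apply σ.f, ← mul_assoc,
    ← pow_succ', ← Module.End.mul_apply σ.k', ← mul_assoc σ.k', σ.k'_mul_f_pow hq.1,
    smul_mul_assoc, mul_assoc, σ.k'_mul_k_pow_mul_k'_pow, LinearMap.smul_apply,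
    ← TensorProduct.smul_tmul']
  rfl

/-- The map `w ↦ Ř (x_{a-2i} ⊗ w)`. -/
def braidRow (q : ℝ) (a : ℕ) (σ : UqRep q W) (i : ℕ) : W →ₗ[ℂ] W ⊗[ℂ] Spin a :=
  ∑ r ∈ Finset.range (i + 1),
    ((braidCoeff q a i r : ℝ) : ℂ) • braidTerm a σ (2 * i - r) (i - r) r

/-- The braiding `Ř : V^{a/2} ⊗ W → W ⊗ V^{a/2}`, the universal `R`-matrix followed by the flip. Its
factor `q^{h ⊗ h / 4}` acts on `x_{a-2i} ⊗ w` as `k^(a-2i)`, which is encoded as `k^a k'^(2i)`. -/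
def braiding (q : ℝ) (a : ℕ) (σ : UqRep q W) : Spin a ⊗[ℂ] W →ₗ[ℂ] W ⊗[ℂ] Spin a :=
  TensorProduct.lift ((Pi.basisFun ℂ (Fin (a + 1))).constr ℂ fun i => braidRow q a σ i)

theorem braidRow_apply (a : ℕ) (σ : UqRep q W) (i : ℕ) (w : W) :
    braidRow q a σ i w = ∑ r ∈ Finset.range (i + 1),
      ((braidCoeff q a i r : ℝ) : ℂ) • braidTerm a σ (2 * i - r) (i - r) r w := by
  simp only [braidRow, LinearMap.sum_apply, LinearMap.smul_apply]

theorem braidRow_succ_k (a : ℕ) (σ : UqRep q W) (i : ℕ) (w : W) :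
    braidRow q a σ (i + 1) (σ.k w) = ∑ r ∈ Finset.range (i + 2),
      ((braidCoeff q a (i + 1) r : ℝ) : ℂ) • braidTerm a σ (2 * i + 1 - r) (i + 1 - r) r w := by
  rw [braidRow_apply]
  refine Finset.sum_congr rfl fun r hr => ?_
  rw [Finset.mem_range] at hr
  rw [show 2 * (i + 1) - r = 2 * i + 1 - r + 1 by omega, braidTerm_k]

theorem braidRow_f (hq : 0 < q) (a : ℕ) (σ : UqRep q W) (i : ℕ) (w : W) :
    braidRow q a σ i (σ.f w) = ∑ r ∈ Finset.range (i + 1),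
      ((braidCoeff q a i r * q ^ ((2 * (i : ℝ) - r - a) / 2) : ℝ) : ℂ) •
        braidTerm a σ (2 * i - r) (i - r) (r + 1) w := by
  rw [braidRow_apply]
  refine Finset.sum_congr rfl fun r hr => ?_
  rw [Finset.mem_range] at hr
  rw [braidTerm_f hq, smul_smul, Nat.cast_sub (by omega)]
  push_cast
  rfl

theorem tensor_f_braidRow (a : ℕ) (σ : UqRep q W) (i : ℕ) (w : W) :
    (UqRep.tensor hq.1 σ (irrep hq a)).f (braidRow q a σ i w) =
      ∑ r ∈ Finset.range (i + 1),
        ((braidCoeff q a i r * q ^ (((a : ℝ) - 2 * i + 2 * r) / 4) : ℝ) : ℂ) •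
          braidTerm a σ (2 * i - r) (i - r) (r + 1) w +
      ∑ r ∈ Finset.range (i + 2), ((q ^ ((r : ℝ) / 2) * braidCoeff q a i r : ℝ) : ℂ) •
        braidTerm a σ (2 * i + 1 - r) (i + 1 - r) r w := by
  rw [Finset.sum_range_succ _ (i + 1), braidCoeff_eq_zero (Nat.lt_succ_self i), mul_zero,
    Complex.ofReal_zero, zero_smul, add_zero, ← Finset.sum_add_distrib, braidRow_apply, map_sum]
  refine Finset.sum_congr rfl fun r hr => ?_
  rw [Finset.mem_range] at hr
  rw [map_smul, tensor_f_braidTerm, smul_add, smul_smul, smul_smul, ← Complex.ofReal_mul,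
    ← Complex.ofReal_mul, mul_comm _ (q ^ ((r : ℝ) / 2)), Nat.cast_sub (by omega),
    show (a : ℝ) - 2 * (i - r) = a - 2 * i + 2 * r by ring,
    show 2 * i - r + 1 = 2 * i + 1 - r by omega, show i - r + 1 = i + 1 - r by omega]

theorem braidRow_succ_k_add_braidRow_f (a : ℕ) (σ : UqRep q W) (i : ℕ) (w : W) :
    braidRow q a σ (i + 1) (σ.k w) +
        ((q ^ (-((a : ℝ) - 2 * i) / 4) : ℝ) : ℂ) • braidRow q a σ i (σ.f w) =
      (UqRep.tensor hq.1 σ (irrep hq a)).f (braidRow q a σ i w) := by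
  rw [braidRow_succ_k, braidRow_f hq.1, tensor_f_braidRow, Finset.sum_range_succ' _ (i + 1),
    Finset.sum_range_succ' _ (i + 1), braidCoeff_zero, braidCoeff_zero, ← add_assoc,
    Finset.smul_sum, add_right_comm, ← Finset.sum_add_distrib, ← Finset.sum_add_distrib]
  congr 1
  · refine Finset.sum_congr rfl fun r _ => ?_
    rw [show 2 * i + 1 - (r + 1) = 2 * i - r by omega, show i + 1 - (r + 1) = i - r by omega,
      smul_smul, ← Complex.ofReal_mul, ← add_smul, ← add_smul, ← Complex.ofReal_add,
      ← Complex.ofReal_add, braidCoeff_succ_succ hq, Real.rpow_add hq.1]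
    push_cast
    ring_nf
  · simp

theorem braiding_xVec (a : ℕ) (σ : UqRep q W) {i : ℕ} (hi : i ≤ a + 1) (w : W) :
    braiding q a σ (xVec a i ⊗ₜ w) = braidRow q a σ i w := by
  rcases hi.lt_or_eq with h | rfl
  · have hbasis := xVec_coe a ⟨i, h⟩
    rw [Fin.val_mk] at hbasis
    rw [hbasis, braiding, TensorProduct.lift.tmul, Module.Basis.constr_basis]
  · rw [xVec_eq_zero (Nat.lt_succ_self a), TensorProduct.zero_tmul, map_zero, braidRow_apply,
      Finset.sum_range_succ']
    simp [braidCoeff_succ_left_eq_zero, braidTerm_apply, xVec_eq_zero]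

theorem braiding_xVec_zero (a : ℕ) (σ : UqRep q W) (w : W) :
    braiding q a σ (xVec a 0 ⊗ₜ w) = (σ.k ^ a) w ⊗ₜ xVec a 0 := by
  rw [braiding_xVec a σ (Nat.zero_le _), braidRow_apply]
  simp [braidCoeff_zero, braidTerm_apply]

theorem braiding_f (a : ℕ) (σ : UqRep q W) (v : Spin a ⊗[ℂ] W) :
    braiding q a σ ((UqRep.tensor hq.1 (irrep hq a) σ).f v) =
      (UqRep.tensor hq.1 σ (irrep hq a)).f (braiding q a σ v) := by
  suffices h : braiding q a σ ∘ₗ (UqRep.tensor hq.1 (irrep hq a) σ).f =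
      (UqRep.tensor hq.1 σ (irrep hq a)).f ∘ₗ braiding q a σ from LinearMap.congr_fun h v
  refine spin_tensor_ext fun i hi w => ?_
  rw [LinearMap.comp_apply, LinearMap.comp_apply, UqRep.tensor_f_xVec_tmul, map_add, map_smul,
    braiding_xVec a σ (Nat.succ_le_succ hi), braiding_xVec a σ (Nat.le_succ_of_le hi),
    braiding_xVec a σ (Nat.le_succ_of_le hi), braidRow_succ_k_add_braidRow_f]

theorem braiding_k (a : ℕ) (σ : UqRep q W) (v : Spin a ⊗[ℂ] W) :
    braiding q a σ ((UqRep.tensor hq.1 (irrep hq a) σ).k v) =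
      (UqRep.tensor hq.1 σ (irrep hq a)).k (braiding q a σ v) := by
  set T := UqRep.tensor hq.1 (irrep hq a) σ
  set T' := UqRep.tensor hq.1 σ (irrep hq a)
  suffices h : braiding q a σ ∘ₗ T.k = T'.k ∘ₗ braiding q a σ from LinearMap.congr_fun h v
  refine ext_of_map_f hq σ (fun w => ?_) fun v hv => ?_
  · simp only [LinearMap.comp_apply, T, T', UqRep.tensor, TensorProduct.map_tmul, irrep_k,
      ← TensorProduct.smul_tmul', map_smul, braiding_xVec_zero, TensorProduct.tmul_smul]
    rw [← Module.End.mul_apply, ← Module.End.mul_apply, pow_mul_comm']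
  · rw [LinearMap.comp_apply, LinearMap.comp_apply] at hv ⊢
    have hT : T.k (T.f v) = _ := LinearMap.congr_fun T.k_mul_f v
    have hT' : T'.k (T'.f (braiding q a σ v)) = _ := LinearMap.congr_fun T'.k_mul_f _
    rw [hT, braiding_f, hT']
    simp only [LinearMap.smul_apply, Module.End.mul_apply, map_smul, T, braiding_f]
    rw [hv]

theorem braiding_k' (a : ℕ) (σ : UqRep q W) (v : Spin a ⊗[ℂ] W) :
    braiding q a σ ((UqRep.tensor hq.1 (irrep hq a) σ).k' v) =
      (UqRep.tensor hq.1 σ (irrep hq a)).k' (braiding q a σ v) :=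
  UqRep.map_k'_of_map_k (braiding_k hq a σ) v

theorem braiding_e (a : ℕ) (σ : UqRep q W) (v : Spin a ⊗[ℂ] W) :
    braiding q a σ ((UqRep.tensor hq.1 (irrep hq a) σ).e v) =
      (UqRep.tensor hq.1 σ (irrep hq a)).e (braiding q a σ v) := by
  set T := UqRep.tensor hq.1 (irrep hq a) σ with hT
  set T' := UqRep.tensor hq.1 σ (irrep hq a) with hT'
  suffices h : braiding q a σ ∘ₗ T.e = T'.e ∘ₗ braiding q a σ from LinearMap.congr_fun h v
  refine ext_of_map_f hq σ (fun w => ?_) fun v hv => ?_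
  · have hke : (σ.k ^ a) (σ.e w) = _ := LinearMap.congr_fun (σ.k_pow_mul_e hq.1 a) w
    simp only [LinearMap.comp_apply, hT, hT', UqRep.tensor, TensorProduct.map_tmul, irrep_k,
      irrep_k', irrep_e_xVec_zero, ← TensorProduct.smul_tmul', map_smul,
      braiding_xVec_zero, LinearMap.add_apply, TensorProduct.tmul_smul, hke, LinearMap.smul_apply,
      smul_smul, Module.End.mul_apply, TensorProduct.zero_tmul, TensorProduct.tmul_zero, zero_add,
      add_zero]
    rw [← Complex.ofReal_mul, ← Real.rpow_add hq.1]
    ring_nf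
  · rw [LinearMap.comp_apply, LinearMap.comp_apply] at hv ⊢
    have hef : T.e (T.f v) = T.f (T.e v) + _ :=
      sub_eq_iff_eq_add'.1 (LinearMap.congr_fun T.e_f v)
    have hef' : T'.e (T'.f (braiding q a σ v)) = T'.f (T'.e (braiding q a σ v)) + _ :=
      sub_eq_iff_eq_add'.1 (LinearMap.congr_fun T'.e_f (braiding q a σ v))
    rw [← hT, hef, hT, braiding_f, ← hT', hef']
    simp only [LinearMap.smul_apply, LinearMap.sub_apply, Module.End.mul_apply, map_smul, map_add,
      map_sub, braiding_f, braiding_k, braiding_k', hT'] at hv ⊢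
    rw [hv]

theorem isIntertwining_braiding (a : ℕ) (σ : UqRep q W) :
    UqRep.IsIntertwining (UqRep.tensor hq.1 (irrep hq a) σ) (UqRep.tensor hq.1 σ (irrep hq a))
      (braiding q a σ) :=
  ⟨braiding_e hq a σ, braiding_f hq a σ, braiding_k hq a σ⟩

theorem braiding_natural (a : ℕ) {σ : UqRep q W} {σ' : UqRep q W'} {Φ : W →ₗ[ℂ] W'}
    (h : UqRep.IsIntertwining σ σ' Φ) :
    braiding q a σ' ∘ₗ Φ.lTensor (Spin a) = Φ.rTensor (Spin a) ∘ₗ braiding q a σ := by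
  have map_pow : ∀ (A : Module.End ℂ W) (B : Module.End ℂ W'), (∀ v, Φ (A v) = B (Φ v)) →
      ∀ (n : ℕ) v, Φ ((A ^ n) v) = (B ^ n) (Φ v) := fun A B hAB n v => by
    rw [Module.End.pow_apply, Module.End.pow_apply]
    exact (Function.Semiconj.iterate_right hAB n) v
  refine spin_tensor_ext fun i hi w => ?_
  simp only [LinearMap.comp_apply, LinearMap.lTensor_tmul, LinearMap.rTensor_tmul,
    braiding_xVec a _ (Nat.le_succ_of_le hi), braidRow_apply, braidTerm_apply, map_sum, map_smul,
    Module.End.mul_apply, map_pow _ _ h.map_f, map_pow _ _ h.map_k, map_pow _ _ h.map_k']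

/-- The braiding of `V^{a/2}` past the first of two tensor factors. -/
def braidingLeft (q : ℝ) (a : ℕ) (σ : UqRep q W) (W' : Type*) [AddCommGroup W'] [Module ℂ W'] :
    Spin a ⊗[ℂ] (W ⊗[ℂ] W') →ₗ[ℂ] W ⊗[ℂ] (Spin a ⊗[ℂ] W') :=
  (TensorProduct.assoc ℂ W (Spin a) W').toLinearMap ∘ₗ (braiding q a σ).rTensor W' ∘ₗ
    (TensorProduct.assoc ℂ (Spin a) W W').symm.toLinearMap

theorem isIntertwining_braidingLeft (a : ℕ) (σ : UqRep q W) (τ : UqRep q W') :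
    UqRep.IsIntertwining (UqRep.tensor hq.1 (irrep hq a) (UqRep.tensor hq.1 σ τ))
      (UqRep.tensor hq.1 σ (UqRep.tensor hq.1 (irrep hq a) τ)) (braidingLeft q a σ W') :=
  (UqRep.IsIntertwining.assoc hq.1 σ (irrep hq a) τ).comp
    (((isIntertwining_braiding hq a σ).rTensor hq.1 τ).comp
      (UqRep.IsIntertwining.assoc hq.1 (irrep hq a) σ τ).symm)

/-- Both sides intertwine `f`, so it suffices to compare them on `x_a ⊗ W ⊗ W'`, where only powers
of `q^{h/4}` act. -/
theorem braiding_hexagon (a : ℕ) (σ : UqRep q W) (τ : UqRep q W') :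
    (TensorProduct.assoc ℂ W W' (Spin a)).toLinearMap ∘ₗ braiding q a (UqRep.tensor hq.1 σ τ) =
      (braiding q a τ).lTensor W ∘ₗ braidingLeft q a σ W' := by
  have hA := (UqRep.IsIntertwining.assoc hq.1 σ τ (irrep hq a)).comp
    (isIntertwining_braiding hq a (UqRep.tensor hq.1 σ τ))
  have hB := ((isIntertwining_braiding hq a τ).lTensor hq.1 σ).comp
    (isIntertwining_braidingLeft hq a σ τ)
  refine ext_of_map_f hq (UqRep.tensor hq.1 σ τ) (fun w => ?_) fun v hv => ?_
  · induction w using TensorProduct.induction_on with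
    | zero => simp
    | add x y hx hy => simp only [TensorProduct.tmul_add, map_add, hx, hy]
    | tmul x y =>
      have hk : ((UqRep.tensor hq.1 σ τ).k ^ a) (x ⊗ₜ y) = (σ.k ^ a) x ⊗ₜ (τ.k ^ a) y := by
        simp only [UqRep.tensor, TensorProduct.map_pow, TensorProduct.map_tmul]
      simp [braidingLeft, braiding_xVec_zero, hk]
  · rw [hA.map_f, hB.map_f, hv]

end

/-! ### The eigenvalues of the braiding -/

theorem shapovalov_xVec_zero_f_pow_succ (a r : ℕ) (v : Spin a) :
    shapovalov q a (xVec a 0) (((irrep hq a).f ^ (r + 1)) v) = 0 := by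
  rw [pow_succ', Module.End.mul_apply, ← shapovalov_e, irrep_e_xVec_zero, map_zero,
    LinearMap.zero_apply]

theorem irrep_k_pow (n i m : ℕ) :
    ((irrep hq n).k ^ m) (xVec n i) =
      ((q ^ ((m : ℝ) * ((n : ℝ) - 2 * i) / 4) : ℝ) : ℂ) • xVec n i := by
  induction m with
  | zero => simp
  | succ m ih =>
    rw [pow_succ, Module.End.mul_apply, irrep_k, map_smul, ih, smul_smul, ← Complex.ofReal_mul,
      ← Real.rpow_add hq.1]
    push_cast
    ring_nf

theorem irrep_k'_pow (n i m : ℕ) :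
    ((irrep hq n).k' ^ m) (xVec n i) =
      ((q ^ (-(m : ℝ) * ((n : ℝ) - 2 * i) / 4) : ℝ) : ℂ) • xVec n i := by
  induction m with
  | zero => simp
  | succ m ih =>
    rw [pow_succ, Module.End.mul_apply, irrep_k', map_smul, ih, smul_smul, ← Complex.ofReal_mul,
      ← Real.rpow_add hq.1]
    push_cast
    ring_nf

theorem bilinForm_pow_apply {R M : Type*} [CommRing R] [AddCommGroup M] [Module R M]
    {B : LinearMap.BilinForm R M} {A : Module.End R M} (h : ∀ v w, B (A v) w = B v (A w)) (m : ℕ)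
    (v w : M) : B ((A ^ m) v) w = B v ((A ^ m) w) := by
  induction m generalizing v with
  | zero => rfl
  | succ m ih =>
    calc B ((A ^ (m + 1)) v) w = B v (A ((A ^ m) w)) := by
          rw [pow_succ, Module.End.mul_apply, ih, h]
      _ = B v ((A ^ (m + 1)) w) := by rw [pow_succ', Module.End.mul_apply]

theorem shapovalov_xVec_zero_k_pow_mul_k'_pow (a m l : ℕ) (v : Spin a) :
    shapovalov q a (xVec a 0) (((irrep hq a).k ^ m * (irrep hq a).k' ^ l) v) =
      ((q ^ (((m : ℝ) - l) * a / 4) : ℝ) : ℂ) * shapovalov q a (xVec a 0) v := by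
  rw [Module.End.mul_apply, ← bilinForm_pow_apply (shapovalov_k hq a), irrep_k_pow,
    ← bilinForm_pow_apply (shapovalov_k' hq a), map_smul, irrep_k'_pow, smul_smul,
    ← Complex.ofReal_mul, ← Real.rpow_add hq.1, map_smul, LinearMap.smul_apply, smul_eq_mul]
  push_cast
  ring_nf

theorem shapovalovTensor_xVec_zero_braiding_xVec {a b i : ℕ} (hi : i ≤ b) (y : Spin b)
    (z : Spin a) :
    shapovalovTensor q a b (xVec a 0 ⊗ₜ y) (braiding q b (irrep hq a) (xVec b i ⊗ₜ z)) =
      ((q ^ (((b : ℝ) - 2 * i) * a / 4) : ℝ) : ℂ) *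
        (shapovalov q a (xVec a 0) z * shapovalov q b y (xVec b i)) := by
  rw [braiding_xVec b _ (Nat.le_succ_of_le hi), braidRow_apply, Finset.sum_range_succ', map_add,
    map_sum, Finset.sum_eq_zero, zero_add, braidCoeff_zero, Complex.ofReal_one, one_smul,
    braidTerm_apply, shapovalovTensor_tmul, pow_zero, one_mul,
    shapovalov_xVec_zero_k_pow_mul_k'_pow, mul_assoc]
  · rw [Nat.sub_zero, Nat.sub_zero]
    push_cast
    rfl
  · intro r _
    rw [map_smul, braidTerm_apply, shapovalovTensor_tmul, Module.End.mul_apply,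
      shapovalov_xVec_zero_f_pow_succ, zero_mul, smul_zero]

theorem shapovalovTensor_braiding_xVec_zero (a b : ℕ) (y : Spin b) (w : Spin b ⊗[ℂ] Spin a) :
    shapovalovTensor q b a (braiding q a (irrep hq b) (xVec a 0 ⊗ₜ y)) w =
      shapovalovTensor q a b (xVec a 0 ⊗ₜ y) (braiding q b (irrep hq a) w) := by
  suffices h : shapovalovTensor q b a (braiding q a (irrep hq b) (xVec a 0 ⊗ₜ y)) =
      shapovalovTensor q a b (xVec a 0 ⊗ₜ y) ∘ₗ braiding q b (irrep hq a) from
    LinearMap.congr_fun h w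
  refine spin_tensor_ext fun i hi z => ?_
  rw [LinearMap.comp_apply, shapovalovTensor_xVec_zero_braiding_xVec hq hi, braiding_xVec_zero,
    shapovalovTensor_tmul, bilinForm_pow_apply (shapovalov_k hq b), irrep_k_pow, map_smul,
    smul_eq_mul]
  ring_nf

theorem shapovalovTensor_braiding (a b : ℕ) (v : Spin a ⊗[ℂ] Spin b) (w : Spin b ⊗[ℂ] Spin a) :
    shapovalovTensor q b a (braiding q a (irrep hq b) v) w =
      shapovalovTensor q a b v (braiding q b (irrep hq a) w) := by
  suffices h : shapovalovTensor q b a ∘ₗ braiding q a (irrep hq b) =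
      LinearMap.compl₂ (shapovalovTensor q a b) (braiding q b (irrep hq a)) from
    LinearMap.congr_fun₂ h v w
  refine ext_of_map_f hq (irrep hq b)
    (fun y => LinearMap.ext (shapovalovTensor_braiding_xVec_zero hq a b y))
    fun v hv => LinearMap.ext fun w => ?_
  have hv' := LinearMap.congr_fun hv ((UqRep.tensor hq.1 (irrep hq b) (irrep hq a)).e w)
  simp only [LinearMap.comp_apply, LinearMap.compl₂_apply] at hv' ⊢
  rw [braiding_f, shapovalovTensor_f, hv', braiding_e, shapovalovTensor_f]

/-- The pairing of the highest weight vector of `V^{c/2} ⊆ V^{a/2} ⊗ V^{b/2}` with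
`x_{a-2k} ⊗ x_{b-2m}`. -/
def stdEmbeddingCoeff (a b c k m : ℕ) : ℂ :=
  shapovalovTensor q a b (stdEmbedding hq a b c (xVec c 0)) (xVec a k ⊗ₜ xVec b m)

theorem stdEmbeddingCoeff_succ (a b c k m : ℕ) :
    stdEmbeddingCoeff hq a b c (k + 1) m =
      -((q ^ (-((a : ℝ) + b) / 4 + ((k : ℝ) + m) / 2) : ℝ) : ℂ) *
        stdEmbeddingCoeff hq a b c k (m + 1) := by
  have hadj := shapovalovTensor_e hq a b (stdEmbedding hq a b c (xVec c 0)) (xVec a k ⊗ₜ xVec b m)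
  rw [← (isIntertwining_stdEmbedding hq a b c).map_e, irrep_e_xVec_zero, map_zero, map_zero,
    LinearMap.zero_apply, UqRep.tensor_f_xVec_tmul, irrep_f, irrep_k, TensorProduct.tmul_smul,
    map_add, map_smul, map_smul, smul_eq_mul, smul_eq_mul] at hadj
  have hpow_ne : ((q ^ (((b : ℝ) - 2 * m) / 4) : ℝ) : ℂ) ≠ 0 :=
    Complex.ofReal_ne_zero.2 (Real.rpow_pos_of_pos hq.1 _).ne'
  have hpow : q ^ (-((a : ℝ) - 2 * k) / 4) =
      q ^ (((b : ℝ) - 2 * m) / 4) * q ^ (-((a : ℝ) + b) / 4 + ((k : ℝ) + m) / 2) := by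
    rw [← Real.rpow_add hq.1]
    ring_nf
  rw [hpow, Complex.ofReal_mul] at hadj
  refine mul_left_cancel₀ hpow_ne ?_
  rw [stdEmbeddingCoeff, stdEmbeddingCoeff]
  linear_combination -hadj

theorem stdEmbeddingCoeff_eq (a b c k m : ℕ) :
    stdEmbeddingCoeff hq a b c k m =
      (-1) ^ k * ((q ^ ((k : ℝ) * (-((a : ℝ) + b) / 4 + ((k : ℝ) + m - 1) / 2)) : ℝ) : ℂ) *
        stdEmbeddingCoeff hq a b c 0 (k + m) := by
  induction k generalizing m with
  | zero => simp
  | succ k ih =>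
    have hpow : q ^ (((k + 1 : ℕ) : ℝ) *
        (-((a : ℝ) + b) / 4 + (((k + 1 : ℕ) : ℝ) + m - 1) / 2)) =
        q ^ (-((a : ℝ) + b) / 4 + ((k : ℝ) + m) / 2) *
          q ^ ((k : ℝ) * (-((a : ℝ) + b) / 4 + ((k : ℝ) + ((m + 1 : ℕ) : ℝ) - 1) / 2)) := by
      rw [← Real.rpow_add hq.1]
      push_cast
      ring_nf
    rw [stdEmbeddingCoeff_succ, ih, hpow, Complex.ofReal_mul, pow_succ, Nat.succ_add_eq_add_succ]
    ring

theorem exists_stdEmbeddingCoeff_eq_ofReal_pos {a b c : ℕ} (h : Triad a b c) :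
    ∃ p : ℝ, 0 < p ∧ stdEmbeddingCoeff hq a b c 0 ((a + b - c) / 2) = p := by
  obtain ⟨r, hr, hpos⟩ := (isStdEmbedding_stdEmbedding hq h).positive
  have ha : 0 < √(xNormSq q a 0) := Real.sqrt_pos.2 (xNormSq_pos hq (Nat.zero_le a))
  have hb : 0 < √(xNormSq q b ((a + b - c) / 2)) :=
    Real.sqrt_pos.2 (xNormSq_pos hq (by have := h.1; omega))
  have hc : 0 < √(xNormSq q c 0) := Real.sqrt_pos.2 (xNormSq_pos hq (Nat.zero_le c))
  have ha' := Complex.ofReal_ne_zero.2 ha.ne'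
  have hb' := Complex.ofReal_ne_zero.2 hb.ne'
  have hc' := Complex.ofReal_ne_zero.2 hc.ne'
  rw [stdVec, stdVec, stdVec, map_smul, TensorProduct.smul_tmul_smul, map_smul, map_smul,
    LinearMap.smul_apply, smul_eq_mul, smul_eq_mul] at hpos
  refine ⟨√(xNormSq q a 0) * √(xNormSq q b ((a + b - c) / 2)) * √(xNormSq q c 0) * r,
    by positivity, ?_⟩
  rw [stdEmbeddingCoeff]
  push_cast at hpos ⊢
  rw [← hpos]
  field_simp

/-- The eigenvalue of the braiding on `V^j ⊆ V^{j₁} ⊗ V^{j₂}`, as a map to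
`V^j ⊆ V^{j₂} ⊗ V^{j₁}`. -/
def braidEigenvalue (q : ℝ) (a b c : ℕ) : ℂ :=
  (-1) ^ ((a + b - c) / 2) * ((q ^ ((casimir c - casimir a - casimir b) / 2) : ℝ) : ℂ)

theorem braidEigenvalue_ne_zero (hq : q ∈ Set.Ioo (0 : ℝ) 1) (a b c : ℕ) :
    braidEigenvalue q a b c ≠ 0 :=
  mul_ne_zero (pow_ne_zero _ (neg_ne_zero.2 one_ne_zero))
    (Complex.ofReal_ne_zero.2 (Real.rpow_pos_of_pos hq.1 _).ne')

section

variable {hq} {a b c : ℕ} {t t' : ℂ}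

theorem braiding_scalar_mul_stdEmbeddingCoeff
    (ht : braiding q a (irrep hq b) ∘ₗ stdEmbedding hq a b c = t • stdEmbedding hq b a c)
    (l : ℕ) :
    t * stdEmbeddingCoeff hq b a c 0 l = (-1) ^ l *
      ((q ^ (((a : ℝ) * b - (l : ℝ) * (a + 3 * b) + 2 * (l : ℝ) * ((l : ℝ) - 1)) / 4) : ℝ) : ℂ) *
        stdEmbeddingCoeff hq a b c 0 l := by
  calc t * stdEmbeddingCoeff hq b a c 0 l
      = shapovalovTensor q b a (braiding q a (irrep hq b) (stdEmbedding hq a b c (xVec c 0)))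
          (xVec b 0 ⊗ₜ xVec a l) := by
        rw [← LinearMap.comp_apply (braiding q a (irrep hq b)), ht, LinearMap.smul_apply, map_smul,
          LinearMap.smul_apply, smul_eq_mul, stdEmbeddingCoeff]
    _ = ((q ^ ((b : ℝ) * ((a : ℝ) - 2 * l) / 4) : ℝ) : ℂ) * stdEmbeddingCoeff hq a b c l 0 := by
        rw [shapovalovTensor_braiding, braiding_xVec_zero, irrep_k_pow, ← TensorProduct.smul_tmul',
          map_smul, smul_eq_mul, stdEmbeddingCoeff]
    _ = _ := by
        rw [stdEmbeddingCoeff_eq, add_zero, ← mul_assoc, mul_left_comm, ← Complex.ofReal_mul,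
          ← Real.rpow_add hq.1]
        push_cast
        ring_nf

theorem braiding_scalar_symm (h : Triad a b c)
    (ht : braiding q a (irrep hq b) ∘ₗ stdEmbedding hq a b c = t • stdEmbedding hq b a c)
    (ht' : braiding q b (irrep hq a) ∘ₗ stdEmbedding hq b a c = t' • stdEmbedding hq a b c) :
    t = t' := by
  have hadj := shapovalovTensor_braiding hq a b (stdEmbedding hq a b c (xVec c 0))
    (stdEmbedding hq b a c (xVec c 0))
  rw [← LinearMap.comp_apply (braiding q a (irrep hq b)), ht,
    ← LinearMap.comp_apply (braiding q b (irrep hq a)), ht', LinearMap.smul_apply,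
    LinearMap.smul_apply, map_smul, map_smul, LinearMap.smul_apply,
    (isStdEmbedding_stdEmbedding hq h).isometry, (isStdEmbedding_stdEmbedding hq h.swap).isometry,
    shapovalov_xVec _ _ _ _ (Nat.zero_le c), if_pos rfl] at hadj
  exact mul_right_cancel₀ (ofReal_xNormSq_ne_zero hq (0 : Fin (c + 1))) hadj

end

theorem eq_mul_ofReal_of_mul_eq {s t : ℂ} {p p' r r' x : ℝ} (hp : 0 < p) (hp' : 0 < p')
    (hr : 0 < r) (hx : 0 ≤ x) (hs : s * s = 1) (hsq : x ^ 2 = r * r') (h : t * p' = s * r * p)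
    (h' : t * p = s * r' * p') : t = s * x := by
  have hst : s * t = ((r * p / p' : ℝ) : ℂ) := by
    rw [Complex.ofReal_div, Complex.ofReal_mul, eq_div_iff (Complex.ofReal_ne_zero.2 hp'.ne')]
    linear_combination s * h + r * p * hs
  have hst' : r * p / p' * p = r' * p' := by
    apply Complex.ofReal_injective
    rw [Complex.ofReal_mul, ← hst, Complex.ofReal_mul]
    linear_combination s * h' + r' * p' * hs
  have hx_eq : x = r * p / p' := by
    refine (pow_left_inj₀ hx (by positivity) two_ne_zero).1 ?_
    rw [hsq]
    field_simp at hst' ⊢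
    linear_combination -hst'
  rw [hx_eq, ← hst]
  linear_combination -t * hs

/-- By Schur's lemma the braiding acts on `V^{c/2}` by a scalar. Comparing the coefficients of
`x_a ⊗ x_{c-a}` expresses this scalar through a ratio of positive reals, and self-adjointness of the
braiding for the Shapovalov forms gives the inverse ratio, so that the ratio drops out. -/
theorem braiding_comp_stdEmbedding (a b c : ℕ) :
    braiding q a (irrep hq b) ∘ₗ stdEmbedding hq a b c =
      braidEigenvalue q a b c • stdEmbedding hq b a c := by
  by_cases h : Triad a b c
  swap
  · rw [stdEmbedding_of_not_triad hq h, stdEmbedding_of_not_triad hq (mt Triad.swap h),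
      LinearMap.comp_zero, smul_zero]
  obtain ⟨t, ht⟩ := ((isIntertwining_braiding hq a (irrep hq b)).comp
    (isIntertwining_stdEmbedding hq a b c)).exists_eq_smul_stdEmbedding
  obtain ⟨t', ht'⟩ := ((isIntertwining_braiding hq b (irrep hq a)).comp
    (isIntertwining_stdEmbedding hq b a c)).exists_eq_smul_stdEmbedding
  obtain rfl := braiding_scalar_symm h ht ht'
  obtain ⟨p, hp, hpe⟩ := exists_stdEmbeddingCoeff_eq_ofReal_pos hq h
  obtain ⟨p', hp', hpe'⟩ := exists_stdEmbeddingCoeff_eq_ofReal_pos hq h.swap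
  rw [add_comm b a] at hpe'
  have hab := braiding_scalar_mul_stdEmbeddingCoeff ht ((a + b - c) / 2)
  have hba := braiding_scalar_mul_stdEmbeddingCoeff ht' ((a + b - c) / 2)
  rw [hpe, hpe'] at hab hba
  rw [ht, braidEigenvalue]
  congr 1
  refine eq_mul_ofReal_of_mul_eq hp hp' (Real.rpow_pos_of_pos hq.1 _)
    (Real.rpow_pos_of_pos hq.1 _).le (by rw [← mul_pow]; simp) ?_ hab hba
  have hc : (c : ℝ) = a + b - 2 * ((a + b - c) / 2 : ℕ) := by
    obtain ⟨-, -, hle, m, hm⟩ := h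
    rw [eq_sub_iff_add_eq]
    exact_mod_cast (by omega : c + 2 * ((a + b - c) / 2) = a + b)
  rw [← Real.rpow_add hq.1, ← Real.rpow_natCast, ← Real.rpow_mul hq.1.le]
  generalize (a + b - c) / 2 = l at hc
  rw [casimir, casimir, casimir, hc]
  push_cast
  ring_nf

theorem braidEigenvalue_symm (q : ℝ) (a b c : ℕ) :
    braidEigenvalue q b a c = braidEigenvalue q a b c := by
  rw [braidEigenvalue, braidEigenvalue, add_comm b a, sub_right_comm]

theorem stdProj_comp_braiding (a b c : ℕ) :
    stdProj hq b a c ∘ₗ braiding q a (irrep hq b) = braidEigenvalue q a b c • stdProj hq a b c := by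
  refine LinearMap.ext fun v => ext_shapovalov_left hq fun u => ?_
  rw [LinearMap.comp_apply, shapovalov_stdProj, shapovalovTensor_braiding,
    ← LinearMap.comp_apply (braiding q b (irrep hq a)), braiding_comp_stdEmbedding,
    braidEigenvalue_symm, LinearMap.smul_apply, LinearMap.smul_apply, map_smul, map_smul,
    LinearMap.smul_apply, shapovalov_stdProj]

/-! ### Recoupling of threefold tensor products -/

section

variable {R ι U V W : Type*} [CommSemiring R] [AddCommMonoid U] [Module R U] [AddCommMonoid V]
  [Module R V] [AddCommMonoid W] [Module R W]

theorem comp_sum (Φ : V →ₗ[R] W) (s : Finset ι) (Ψ : ι → U →ₗ[R] V) :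
    Φ ∘ₗ ∑ i ∈ s, Ψ i = ∑ i ∈ s, Φ ∘ₗ Ψ i :=
  map_sum (LinearMap.compRight R Φ) Ψ s

theorem sum_comp (s : Finset ι) (Ψ : ι → V →ₗ[R] W) (Φ : U →ₗ[R] V) :
    (∑ i ∈ s, Ψ i) ∘ₗ Φ = ∑ i ∈ s, Ψ i ∘ₗ Φ :=
  map_sum (LinearMap.lcomp R W Φ) Ψ s

end

/-- The embedding of `V^j` in `V^{j₁₂} ⊗ V^{j₃} ⊆ V^{j₁} ⊗ (V^{j₂} ⊗ V^{j₃})`, where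
`j₁, j₂, j₃, j₁₂, j` are half of `a, b, d, c, n`. -/
def leftCoupling (a b d c n : ℕ) : Spin n →ₗ[ℂ] Spin a ⊗[ℂ] (Spin b ⊗[ℂ] Spin d) :=
  (TensorProduct.assoc ℂ (Spin a) (Spin b) (Spin d)).toLinearMap ∘ₗ
    (stdEmbedding hq a b c).rTensor (Spin d) ∘ₗ stdEmbedding hq c d n

/-- The embedding of `V^j` in `V^{j₁} ⊗ V^{j₂₃} ⊆ V^{j₁} ⊗ (V^{j₂} ⊗ V^{j₃})`, where
`j₁, j₂, j₃, j₂₃, j` are half of `a, b, d, p, n`. -/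
def rightCoupling (a b d p n : ℕ) : Spin n →ₗ[ℂ] Spin a ⊗[ℂ] (Spin b ⊗[ℂ] Spin d) :=
  (stdEmbedding hq b d p).lTensor (Spin a) ∘ₗ stdEmbedding hq a p n

/-- The intertwining map `V^{j₁₂} ⊗ V^{j₃} → V^{j₁} ⊗ V^{j₂₃}` that embeds `V^{j₁₂}` in
`V^{j₁} ⊗ V^{j₂}` and then projects `V^{j₂} ⊗ V^{j₃}` to `V^{j₂₃}`, where
`j₁, j₂, j₃, j₁₂, j₂₃` are half of `a, b, d, c, p`. -/
def recoupling (a b d c p : ℕ) : Spin c ⊗[ℂ] Spin d →ₗ[ℂ] Spin a ⊗[ℂ] Spin p :=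
  (stdProj hq b d p).lTensor (Spin a) ∘ₗ
    (TensorProduct.assoc ℂ (Spin a) (Spin b) (Spin d)).toLinearMap ∘ₗ
      (stdEmbedding hq a b c).rTensor (Spin d)

theorem isIntertwining_leftCoupling (a b d c n : ℕ) :
    UqRep.IsIntertwining (irrep hq n)
      (UqRep.tensor hq.1 (irrep hq a) (UqRep.tensor hq.1 (irrep hq b) (irrep hq d)))
      (leftCoupling hq a b d c n) :=
  (UqRep.IsIntertwining.assoc hq.1 _ _ _).comp
    (((isIntertwining_stdEmbedding hq a b c).rTensor hq.1 _).comp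
      (isIntertwining_stdEmbedding hq c d n))

theorem lTensor_stdProj_comp_leftCoupling (a b d c n p : ℕ) :
    (stdProj hq b d p).lTensor (Spin a) ∘ₗ leftCoupling hq a b d c n =
      recoupling hq a b d c p ∘ₗ stdEmbedding hq c d n :=
  rfl

theorem sum_lTensor_stdEmbedding_stdProj (U : Type*) [AddCommGroup U] [Module ℂ U] (a b : ℕ)
    (v : U ⊗[ℂ] (Spin a ⊗[ℂ] Spin b)) :
    ∑ c ∈ Finset.range (a + b + 1) with Triad a b c,
      (stdEmbedding hq a b c).lTensor U ((stdProj hq a b c).lTensor U v) = v := by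
  have h := congrArg (LinearMap.lTensorHom U) (sum_stdEmbedding_comp_stdProj hq a b)
  simp only [map_sum, LinearMap.coe_lTensorHom, LinearMap.lTensor_comp, LinearMap.lTensor_id] at h
  have h_apply := LinearMap.congr_fun h v
  rw [LinearMap.sum_apply] at h_apply
  exact h_apply

theorem rightCoupling_of_not_triad {a b d p : ℕ} (h : ¬ Triad b d p) (n : ℕ) :
    rightCoupling hq a b d p n = 0 := by
  rw [rightCoupling, stdEmbedding_of_not_triad hq h, LinearMap.lTensor_zero, LinearMap.zero_comp]

theorem exists_leftCoupling_eq_sum (a b d c n : ℕ) : ∃ w : ℕ → ℂ, leftCoupling hq a b d c n =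
    ∑ p ∈ Finset.range (b + d + 1) with Triad b d p ∧ Triad a p n,
      w p • rightCoupling hq a b d p n := by
  choose w hw using fun p => (((isIntertwining_stdProj hq b d p).lTensor hq.1 (irrep hq a)).comp
    (isIntertwining_leftCoupling hq a b d c n)).exists_eq_smul_stdEmbedding
  refine ⟨w, LinearMap.ext fun v => ?_⟩
  rw [← sum_lTensor_stdEmbedding_stdProj hq (Spin a) b d (leftCoupling hq a b d c n v),
    LinearMap.sum_apply, ← Finset.filter_filter, Finset.sum_filter fun p => Triad a p n]
  refine Finset.sum_congr rfl fun p _ => ?_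
  rw [← LinearMap.comp_apply ((stdProj hq b d p).lTensor _), hw, LinearMap.smul_apply, map_smul]
  split_ifs with hp
  · rfl
  · rw [stdEmbedding_of_not_triad hq hp, LinearMap.zero_apply, map_zero, smul_zero]

theorem leftCoupling_eq_sum_racah (a b d c n : ℕ) : leftCoupling hq a b d c n =
    ∑ p ∈ Finset.range (b + d + 1) with Triad b d p ∧ Triad a p n,
      racah hq a b d c n p • rightCoupling hq a b d p n := by
  have hex : ∃ W : ℕ → ℂ, ∀ i ≤ n, leftBasis hq a b d c n i =
      ∑ p ∈ Finset.range (b + d + 1) with Triad b d p ∧ Triad a p n,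
        W p • rightBasis hq a b d p n i := by
    obtain ⟨w, hw⟩ := exists_leftCoupling_eq_sum hq a b d c n
    refine ⟨w, fun i _ => ?_⟩
    have h_apply := LinearMap.congr_fun hw (stdVec q n i)
    rw [LinearMap.sum_apply] at h_apply
    exact h_apply
  have racah_eq : racah hq a b d c n = hex.choose := by
    ext p
    rw [racah, dif_pos hex]
  refine end_ext fun i hi => ?_
  have hsqrt : ((√(xNormSq q n i) : ℝ) : ℂ) ≠ 0 :=
    Complex.ofReal_ne_zero.2 (Real.sqrt_pos.2 (xNormSq_pos hq hi)).ne'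
  have hx : xVec n i = ((√(xNormSq q n i) : ℝ) : ℂ) • stdVec q n i := by
    rw [stdVec, Complex.ofReal_inv, smul_inv_smul₀ hsqrt]
  rw [hx, map_smul, map_smul, LinearMap.sum_apply, racah_eq]
  exact congrArg _ (hex.choose_spec i hi)

theorem recoupling_comp_stdEmbedding {b d p : ℕ} (h : Triad b d p) (a c n : ℕ) :
    recoupling hq a b d c p ∘ₗ stdEmbedding hq c d n =
      racah hq a b d c n p • stdEmbedding hq a p n := by
  have proj_rightCoupling : ∀ p', (stdProj hq b d p).lTensor (Spin a) ∘ₗ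
      rightCoupling hq a b d p' n =
        (stdProj hq b d p ∘ₗ stdEmbedding hq b d p').lTensor (Spin a) ∘ₗ stdEmbedding hq a p' n :=
    fun p' => by rw [rightCoupling, ← LinearMap.comp_assoc, ← LinearMap.lTensor_comp]
  rw [← lTensor_stdProj_comp_leftCoupling, leftCoupling_eq_sum_racah]
  simp only [comp_sum, LinearMap.comp_smul, proj_rightCoupling]
  rw [Finset.sum_eq_single p]
  · rw [stdProj_comp_stdEmbedding hq h, LinearMap.lTensor_id, LinearMap.id_comp]
  · intro p' _ hp'
    rw [stdProj_comp_stdEmbedding_of_ne hq hp', LinearMap.lTensor_zero, LinearMap.zero_comp,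
      smul_zero]
  · intro hp
    have h_triad : ¬ Triad a p n := fun h' => hp <| Finset.mem_filter.2
      ⟨(Finset.mem_filter.1 h.mem_filter_range).1, h, h'⟩
    rw [stdEmbedding_of_not_triad hq h_triad, LinearMap.comp_zero, smul_zero]

theorem stdProj_of_not_triad {a b c : ℕ} (h : ¬ Triad a b c) : stdProj hq a b c = 0 := by
  refine LinearMap.ext fun v => ext_shapovalov_left hq fun u => ?_
  rw [shapovalov_stdProj, stdEmbedding_of_not_triad hq h, LinearMap.zero_apply, map_zero,
    LinearMap.zero_apply, map_zero, LinearMap.zero_apply]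

theorem ext_comp_stdEmbedding {M : Type*} [AddCommGroup M] [Module ℂ M] {a b : ℕ}
    {Φ Ψ : Spin a ⊗[ℂ] Spin b →ₗ[ℂ] M}
    (h : ∀ c, Φ ∘ₗ stdEmbedding hq a b c = Ψ ∘ₗ stdEmbedding hq a b c) : Φ = Ψ := by
  refine LinearMap.ext fun v => ?_
  rw [← LinearMap.id_apply (R := ℂ) v, ← sum_stdEmbedding_comp_stdProj hq a b,
    LinearMap.sum_apply, map_sum, map_sum]
  exact Finset.sum_congr rfl fun c _ => LinearMap.congr_fun (h c) (stdProj hq a b c v)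

theorem stdProj_comp_recoupling {a b d p n : ℕ} (hp : Triad b d p) (hn : Triad a p n) (c : ℕ) :
    stdProj hq a p n ∘ₗ recoupling hq a b d c p = racah hq a b d c n p • stdProj hq c d n := by
  refine ext_comp_stdEmbedding hq fun m => ?_
  rw [LinearMap.comp_assoc, LinearMap.smul_comp]
  rcases eq_or_ne n m with rfl | hnm
  · by_cases h : Triad c d n
    · rw [recoupling_comp_stdEmbedding hq hp, LinearMap.comp_smul,
        stdProj_comp_stdEmbedding hq hn, stdProj_comp_stdEmbedding hq h]
    · rw [stdEmbedding_of_not_triad hq h, LinearMap.comp_zero, LinearMap.comp_zero,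
        LinearMap.comp_zero, smul_zero]
  · rw [recoupling_comp_stdEmbedding hq hp, LinearMap.comp_smul,
      stdProj_comp_stdEmbedding_of_ne hq hnm.symm, stdProj_comp_stdEmbedding_of_ne hq hnm.symm,
      smul_zero, smul_zero]

theorem assoc_comp_braiding_comp_rightCoupling (a b d p n : ℕ) :
    (TensorProduct.assoc ℂ (Spin b) (Spin d) (Spin a)).toLinearMap ∘ₗ
        braiding q a (UqRep.tensor hq.1 (irrep hq b) (irrep hq d)) ∘ₗ rightCoupling hq a b d p n =
      braidEigenvalue q a p n • leftCoupling hq b d a p n := by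
  rw [rightCoupling, ← LinearMap.comp_assoc _ _ (braiding q a _),
    braiding_natural a (isIntertwining_stdEmbedding hq b d p), LinearMap.comp_assoc,
    braiding_comp_stdEmbedding, LinearMap.comp_smul, LinearMap.comp_smul, leftCoupling]

/-- The braiding of `V^{j₁}` past `V^{j₂} ⊗ V^{j₃}`, followed by the projection of
`V^{j₃} ⊗ V^{j₁}` to `V^j`, where `j₁, j₂, j₃, j` are half of `a, b, d, r`. -/
def braidProj (a b d r : ℕ) : Spin a ⊗[ℂ] (Spin b ⊗[ℂ] Spin d) →ₗ[ℂ] Spin b ⊗[ℂ] Spin r :=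
  (stdProj hq d a r).lTensor (Spin b) ∘ₗ
    (TensorProduct.assoc ℂ (Spin b) (Spin d) (Spin a)).toLinearMap ∘ₗ
      braiding q a (UqRep.tensor hq.1 (irrep hq b) (irrep hq d))

theorem braidProj_comp_rightCoupling {d a r : ℕ} (h : Triad d a r) (b p n : ℕ) :
    braidProj hq a b d r ∘ₗ rightCoupling hq a b d p n =
      (braidEigenvalue q a p n * racah hq b d a p n r) • stdEmbedding hq b r n := by
  rw [braidProj, LinearMap.comp_assoc, LinearMap.comp_assoc,
    assoc_comp_braiding_comp_rightCoupling, LinearMap.comp_smul,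
    lTensor_stdProj_comp_leftCoupling, recoupling_comp_stdEmbedding hq h, smul_smul]

theorem braidProj_eq (a b d r : ℕ) :
    braidProj hq a b d r = braidEigenvalue q a d r •
      (stdProj hq a d r).lTensor (Spin b) ∘ₗ braidingLeft q a (irrep hq b) (Spin d) := by
  rw [braidProj, braiding_hexagon hq, ← LinearMap.comp_assoc, ← LinearMap.lTensor_comp,
    stdProj_comp_braiding, LinearMap.lTensor_smul, LinearMap.smul_comp]

theorem lTensor_stdProj_comp_braidingLeft_comp_rightCoupling {a d x : ℕ} (h : Triad a d x)
    (b p n : ℕ) :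
    (stdProj hq a d x).lTensor (Spin b) ∘ₗ braidingLeft q a (irrep hq b) (Spin d) ∘ₗ
        rightCoupling hq a b d p n =
      (braidEigenvalue q a p n * racah hq b d a p n x * (braidEigenvalue q a d x)⁻¹) •
        stdEmbedding hq b x n := by
  have h_eq := braidProj_comp_rightCoupling hq h.swap b p n
  rw [braidProj_eq, LinearMap.smul_comp, LinearMap.comp_assoc] at h_eq
  rw [mul_comm, ← smul_smul, ← h_eq, inv_smul_smul₀ (braidEigenvalue_ne_zero hq a d x)]

theorem braidingLeft_comp_rightCoupling (a b d p n : ℕ) :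
    braidingLeft q a (irrep hq b) (Spin d) ∘ₗ rightCoupling hq a b d p n =
      ∑ x ∈ Finset.range (a + d + 1) with Triad a d x,
        (braidEigenvalue q a p n * racah hq b d a p n x * (braidEigenvalue q a d x)⁻¹) •
          rightCoupling hq b a d x n := by
  refine LinearMap.ext fun v => ?_
  rw [← sum_lTensor_stdEmbedding_stdProj hq (Spin b) a d
    ((braidingLeft q a (irrep hq b) (Spin d) ∘ₗ rightCoupling hq a b d p n) v),
    LinearMap.sum_apply]
  refine Finset.sum_congr rfl fun x hx => ?_
  rw [← LinearMap.comp_apply ((stdProj hq a d x).lTensor _),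
    lTensor_stdProj_comp_braidingLeft_comp_rightCoupling hq (Finset.mem_filter.1 hx).2,
    LinearMap.smul_apply, map_smul]
  rfl

/-- The common map of both evaluations: the recoupling
`V^{j₄} ⊗ V^{j₃} → V^{j₁} ⊗ V^{j₅} ⊗ V^{j₃} → V^{j₁} ⊗ (V^{j₂} ⊗ V^{j₇})` through
`V^{j₅} ⊆ V^{j₂} ⊗ V^{j₆}` and `V^{j₇} ⊆ V^{j₆} ⊗ V^{j₃}`, followed by the braiding of `V^{j₁}` past
`V^{j₂} ⊗ V^{j₇}` and by the projection of `V^{j₇} ⊗ V^{j₁}` to `V^{j₈}`. Here `jᵢ` is half of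
`nᵢ`. -/
def braidedRecoupling (n₁ n₂ n₃ n₄ n₅ n₆ n₇ n₈ : ℕ) :
    Spin n₄ ⊗[ℂ] Spin n₃ →ₗ[ℂ] Spin n₂ ⊗[ℂ] Spin n₈ :=
  braidProj hq n₁ n₂ n₇ n₈ ∘ₗ (recoupling hq n₂ n₆ n₃ n₅ n₇).lTensor (Spin n₁) ∘ₗ
    (TensorProduct.assoc ℂ (Spin n₁) (Spin n₅) (Spin n₃)).toLinearMap ∘ₗ
      (stdEmbedding hq n₁ n₅ n₄).rTensor (Spin n₃)

theorem lTensor_recoupling_comp_rightCoupling {b d p : ℕ} (h : Triad b d p) (e a c x n : ℕ) :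
    (recoupling hq a b d c p).lTensor (Spin e) ∘ₗ rightCoupling hq e c d x n =
      racah hq a b d c x p • rightCoupling hq e a p x n := by
  rw [rightCoupling, ← LinearMap.comp_assoc, ← LinearMap.lTensor_comp,
    recoupling_comp_stdEmbedding hq h, LinearMap.lTensor_smul, LinearMap.smul_comp, rightCoupling]

theorem braidedRecoupling_comp_stdEmbedding_via_rightCoupling {n₁ n₃ n₆ n₇ n₈ : ℕ}
    (h₁₇₈ : Triad n₇ n₁ n₈) (h₃₆₇ : Triad n₆ n₃ n₇) (n₂ n₄ n₅ n₉ : ℕ) :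
    braidedRecoupling hq n₁ n₂ n₃ n₄ n₅ n₆ n₇ n₈ ∘ₗ stdEmbedding hq n₄ n₃ n₉ =
      (∑ x ∈ Finset.range (n₁ + n₉ + 1) with Triad n₁ n₉ x ∧ Triad n₂ n₇ x ∧ Triad n₃ n₅ x,
        racah hq n₁ n₅ n₃ n₄ n₉ x * racah hq n₂ n₆ n₃ n₅ x n₇ *
          (braidEigenvalue q n₁ x n₉ * racah hq n₂ n₇ n₁ x n₉ n₈)) • stdEmbedding hq n₂ n₈ n₉ := by
  have eq_comp_leftCoupling :
      braidedRecoupling hq n₁ n₂ n₃ n₄ n₅ n₆ n₇ n₈ ∘ₗ stdEmbedding hq n₄ n₃ n₉ =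
        braidProj hq n₁ n₂ n₇ n₈ ∘ₗ (recoupling hq n₂ n₆ n₃ n₅ n₇).lTensor (Spin n₁) ∘ₗ
          leftCoupling hq n₁ n₅ n₃ n₄ n₉ := rfl
  rw [eq_comp_leftCoupling, leftCoupling_eq_sum_racah, Finset.sum_smul]
  simp only [comp_sum, LinearMap.comp_smul, lTensor_recoupling_comp_rightCoupling hq h₃₆₇,
    smul_smul]
  refine (Finset.sum_subset_zero_on_sdiff (fun x hx => ?_) (fun x hx => ?_) fun x _ => ?_).symm
  · simp only [Finset.mem_filter, Finset.mem_range, Triad, Nat.even_iff] at hx ⊢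
    omega
  · have h₂₇ : ¬ Triad n₂ n₇ x := by
      simp only [Finset.mem_sdiff, Finset.mem_filter, Finset.mem_range, Triad, Nat.even_iff]
        at hx ⊢
      omega
    rw [rightCoupling_of_not_triad hq h₂₇, LinearMap.comp_zero, smul_zero]
  · rw [braidProj_comp_rightCoupling hq h₁₇₈, smul_smul]

theorem braidingLeft_comp_lTensor_comp_assoc {U V V' W W' : Type*} [AddCommGroup U]
    [Module ℂ U] [AddCommGroup V] [Module ℂ V] [AddCommGroup V'] [Module ℂ V'] [AddCommGroup W]
    [Module ℂ W] [AddCommGroup W'] [Module ℂ W'] (a : ℕ) (σ : UqRep q W) (Φ : V →ₗ[ℂ] W ⊗[ℂ] W')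
    (Ψ : W' ⊗[ℂ] U →ₗ[ℂ] V') :
    braidingLeft q a σ V' ∘ₗ
        (Ψ.lTensor W ∘ₗ (TensorProduct.assoc ℂ W W' U).toLinearMap ∘ₗ Φ.rTensor U).lTensor
          (Spin a) ∘ₗ (TensorProduct.assoc ℂ (Spin a) V U).toLinearMap =
      (Ψ.lTensor (Spin a) ∘ₗ (TensorProduct.assoc ℂ (Spin a) W' U).toLinearMap).lTensor W ∘ₗ
        (TensorProduct.assoc ℂ W (Spin a ⊗[ℂ] W') U).toLinearMap ∘ₗ
          (braidingLeft q a σ W' ∘ₗ Φ.lTensor (Spin a)).rTensor U := by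
  refine TensorProduct.ext_threefold fun x v u => ?_
  simp only [LinearMap.comp_apply, LinearEquiv.coe_coe, TensorProduct.assoc_tmul,
    LinearMap.lTensor_tmul, LinearMap.rTensor_tmul, braidingLeft]
  induction Φ v using TensorProduct.induction_on with
  | zero => simp
  | add y z hy hz => simp only [TensorProduct.tmul_add, TensorProduct.add_tmul, map_add, hy, hz]
  | tmul w w' =>
    simp only [TensorProduct.assoc_tmul, LinearMap.lTensor_tmul, TensorProduct.assoc_symm_tmul,
      LinearMap.rTensor_tmul]
    induction braiding q a σ (x ⊗ₜ w) using TensorProduct.induction_on with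
    | zero => simp
    | add y z hy hz => simp only [TensorProduct.add_tmul, map_add, hy, hz]
    | tmul y z =>
      simp only [TensorProduct.assoc_tmul, LinearMap.lTensor_tmul, LinearMap.comp_apply,
        LinearEquiv.coe_coe]

theorem lTensor_comp_assoc_comp_rTensor_rightCoupling {b d p n : ℕ} (e a c m : ℕ)
    (hp : Triad b d p) (hn : Triad a p n) :
    (stdProj hq a p n ∘ₗ (stdProj hq b d p).lTensor (Spin a) ∘ₗ
        (TensorProduct.assoc ℂ (Spin a) (Spin b) (Spin d)).toLinearMap).lTensor (Spin e) ∘ₗ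
      (TensorProduct.assoc ℂ (Spin e) (Spin a ⊗[ℂ] Spin b) (Spin d)).toLinearMap ∘ₗ
        (rightCoupling hq e a b c m).rTensor (Spin d) =
      racah hq a b d c n p • recoupling hq e c d m n := by
  rw [rightCoupling, LinearMap.rTensor_comp, ← LinearMap.comp_assoc _ _ (LinearEquiv.toLinearMap _),
    ← LinearMap.lTensor_rTensor_comp_assoc, LinearMap.comp_assoc, ← LinearMap.comp_assoc,
    ← LinearMap.lTensor_comp, LinearMap.comp_assoc, LinearMap.comp_assoc, ← recoupling,
    stdProj_comp_recoupling hq hp hn, LinearMap.lTensor_smul, LinearMap.smul_comp, recoupling]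

theorem braidedRecoupling_eq (n₁ n₂ n₃ n₄ n₅ n₆ n₇ n₈ : ℕ) :
    braidedRecoupling hq n₁ n₂ n₃ n₄ n₅ n₆ n₇ n₈ = braidEigenvalue q n₁ n₇ n₈ •
      (stdProj hq n₁ n₇ n₈ ∘ₗ (stdProj hq n₆ n₃ n₇).lTensor (Spin n₁) ∘ₗ
          (TensorProduct.assoc ℂ (Spin n₁) (Spin n₆) (Spin n₃)).toLinearMap).lTensor (Spin n₂) ∘ₗ
        (TensorProduct.assoc ℂ (Spin n₂) (Spin n₁ ⊗[ℂ] Spin n₆) (Spin n₃)).toLinearMap ∘ₗ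
          (braidingLeft q n₁ (irrep hq n₂) (Spin n₆) ∘ₗ
            rightCoupling hq n₁ n₂ n₆ n₅ n₄).rTensor (Spin n₃) := by
  have pull_braiding := congrArg (· ∘ₗ (stdEmbedding hq n₁ n₅ n₄).rTensor (Spin n₃))
    (braidingLeft_comp_lTensor_comp_assoc n₁ (irrep hq n₂) (stdEmbedding hq n₂ n₆ n₅)
      (stdProj hq n₆ n₃ n₇))
  simp only [LinearMap.comp_assoc, ← LinearMap.rTensor_comp] at pull_braiding
  rw [braidedRecoupling, braidProj_eq, LinearMap.smul_comp, LinearMap.comp_assoc, recoupling,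
    pull_braiding, ← LinearMap.comp_assoc, ← LinearMap.lTensor_comp, rightCoupling]

theorem braidedRecoupling_eq_sum {n₁ n₃ n₆ n₇ n₈ : ℕ} (h₁₇₈ : Triad n₁ n₇ n₈)
    (h₃₆₇ : Triad n₆ n₃ n₇) (n₂ n₄ n₅ : ℕ) :
    braidedRecoupling hq n₁ n₂ n₃ n₄ n₅ n₆ n₇ n₈ =
      ∑ x ∈ Finset.range (n₁ + n₆ + 1) with Triad n₁ n₆ x,
        (braidEigenvalue q n₁ n₇ n₈ * (braidEigenvalue q n₁ n₅ n₄ * racah hq n₂ n₆ n₁ n₅ n₄ x *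
          (braidEigenvalue q n₁ n₆ x)⁻¹ * racah hq n₁ n₆ n₃ x n₈ n₇)) •
            recoupling hq n₂ x n₃ n₄ n₈ := by
  have rTensor_eq_sum := congrArg (LinearMap.rTensorHom (Spin n₃))
    (braidingLeft_comp_rightCoupling hq n₁ n₂ n₆ n₅ n₄)
  simp only [map_sum, map_smul, LinearMap.coe_rTensorHom] at rTensor_eq_sum
  rw [braidedRecoupling_eq, rTensor_eq_sum]
  simp only [comp_sum, LinearMap.comp_smul, Finset.smul_sum, smul_smul,
    lTensor_comp_assoc_comp_rTensor_rightCoupling hq _ _ _ _ h₃₆₇ h₁₇₈]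

theorem recoupling_of_not_triad_left {a b c : ℕ} (h : ¬ Triad a b c) (d p : ℕ) :
    recoupling hq a b d c p = 0 := by
  rw [recoupling, stdEmbedding_of_not_triad hq h, LinearMap.rTensor_zero, LinearMap.comp_zero,
    LinearMap.comp_zero]

theorem recoupling_of_not_triad_right {b d p : ℕ} (h : ¬ Triad b d p) (a c : ℕ) :
    recoupling hq a b d c p = 0 := by
  rw [recoupling, stdProj_of_not_triad hq h, LinearMap.lTensor_zero, LinearMap.zero_comp]

theorem braidedRecoupling_comp_stdEmbedding_via_hexagon {n₁ n₃ n₆ n₇ n₈ : ℕ} (h₁₇₈ : Triad n₁ n₇ n₈)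
    (h₃₆₇ : Triad n₆ n₃ n₇) (n₂ n₄ n₅ n₉ : ℕ) :
    braidedRecoupling hq n₁ n₂ n₃ n₄ n₅ n₆ n₇ n₈ ∘ₗ stdEmbedding hq n₄ n₃ n₉ =
      (∑ x ∈ Finset.range (n₁ + n₆ + 1) with Triad n₁ n₆ x ∧ Triad n₂ n₄ x ∧ Triad n₃ n₈ x,
        braidEigenvalue q n₁ n₇ n₈ * (braidEigenvalue q n₁ n₅ n₄ * racah hq n₂ n₆ n₁ n₅ n₄ x *
          (braidEigenvalue q n₁ n₆ x)⁻¹ * racah hq n₁ n₆ n₃ x n₈ n₇) *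
            racah hq n₂ x n₃ n₄ n₉ n₈) • stdEmbedding hq n₂ n₈ n₉ := by
  rw [braidedRecoupling_eq_sum hq h₁₇₈ h₃₆₇, sum_comp, Finset.sum_smul]
  refine (Finset.sum_subset_zero_on_sdiff (fun x hx => ?_) (fun x hx => ?_) fun x hx => ?_).symm
  · simp only [Finset.mem_filter] at hx ⊢
    exact ⟨hx.1, hx.2.1⟩
  · have h : ¬ Triad n₂ x n₄ ∨ ¬ Triad x n₃ n₈ := by
      simp only [Finset.mem_sdiff, Finset.mem_filter, Finset.mem_range, Triad, Nat.even_iff]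
        at hx ⊢
      omega
    rcases h with h | h
    · rw [recoupling_of_not_triad_left hq h, smul_zero, LinearMap.zero_comp]
    · rw [recoupling_of_not_triad_right hq h, smul_zero, LinearMap.zero_comp]
  · obtain ⟨-, -, h₃₈⟩ := (Finset.mem_filter.1 hx).2
    rw [LinearMap.smul_comp, recoupling_comp_stdEmbedding hq (Triad.rotate h₃₈), smul_smul]

theorem smul_stdEmbedding_injective {a b c : ℕ} (h : Triad a b c) :
    Function.Injective fun s : ℂ => s • stdEmbedding hq a b c := fun s t hst => by
  have h_proj := congrArg (stdProj hq a b c ∘ₗ ·) hst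
  simp only [LinearMap.comp_smul, stdProj_comp_stdEmbedding hq h] at h_proj
  exact smul_left_injective ℂ (one_ne_zero (α := Module.End ℂ (Spin c))) h_proj

theorem racah_yangBaxter {n₁ n₂ n₃ n₄ n₅ n₆ n₇ n₈ n₉ : ℕ} (h₁₇₈ : Triad n₁ n₇ n₈)
    (h₂₈₉ : Triad n₂ n₈ n₉) (h₃₆₇ : Triad n₆ n₃ n₇) :
    ∑ x ∈ Finset.range (n₁ + n₉ + 1) with Triad n₁ n₉ x ∧ Triad n₂ n₇ x ∧ Triad n₃ n₅ x,
      racah hq n₁ n₅ n₃ n₄ n₉ x * racah hq n₂ n₆ n₃ n₅ x n₇ *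
        (braidEigenvalue q n₁ x n₉ * racah hq n₂ n₇ n₁ x n₉ n₈) =
    ∑ x ∈ Finset.range (n₁ + n₆ + 1) with Triad n₁ n₆ x ∧ Triad n₂ n₄ x ∧ Triad n₃ n₈ x,
      braidEigenvalue q n₁ n₇ n₈ * (braidEigenvalue q n₁ n₅ n₄ * racah hq n₂ n₆ n₁ n₅ n₄ x *
        (braidEigenvalue q n₁ n₆ x)⁻¹ * racah hq n₁ n₆ n₃ x n₈ n₇) *
          racah hq n₂ x n₃ n₄ n₉ n₈ := by
  have via_rightCoupling :=
    braidedRecoupling_comp_stdEmbedding_via_rightCoupling hq h₁₇₈.swap h₃₆₇ n₂ n₄ n₅ n₉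
  have via_hexagon := braidedRecoupling_comp_stdEmbedding_via_hexagon hq h₁₇₈ h₃₆₇ n₂ n₄ n₅ n₉
  exact smul_stdEmbedding_injective hq h₂₈₉ (via_rightCoupling.symm.trans via_hexagon)

/-! ### From Racah coefficients to `6j` symbols -/

theorem I_pow_congr {m n : ℕ} (h : m ≡ n [MOD 4]) : Complex.I ^ m = Complex.I ^ n := by
  rw [Complex.I_pow_eq_pow_mod, h, ← Complex.I_pow_eq_pow_mod]

theorem neg_one_pow_eq_I_pow (n : ℕ) : (-1 : ℂ) ^ n = Complex.I ^ (2 * n) := by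
  rw [pow_mul, Complex.I_sq]

/-- Writing the signs as powers of `I` removes the truncated halves from their exponents, which then
need only be compared modulo `4`. -/
theorem neg_one_pow_half_eq_I_pow {m : ℕ} (h : Even m) : (-1 : ℂ) ^ (m / 2) = Complex.I ^ m := by
  rw [neg_one_pow_eq_I_pow, Nat.mul_div_cancel' h.two_dvd]

theorem braidEigenvalue_eq {a b c : ℕ} (h : Triad a b c) :
    braidEigenvalue q a b c =
      Complex.I ^ (a + b + 3 * c) * ((q ^ ((casimir c - casimir a - casimir b) / 2) : ℝ) : ℂ) := by
  obtain ⟨-, -, hle, heven⟩ := h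
  rw [Nat.even_iff] at heven
  rw [braidEigenvalue, neg_one_pow_half_eq_I_pow (Nat.even_iff.2 (by omega)),
    I_pow_congr (n := a + b + 3 * c)]
  rw [Nat.ModEq]
  omega

theorem inv_braidEigenvalue_eq {a b c : ℕ} (h : Triad a b c) :
    (braidEigenvalue q a b c)⁻¹ = Complex.I ^ (a + b + 3 * c) *
      ((q ^ ((casimir c - casimir a - casimir b) / 2) : ℝ) : ℂ)⁻¹ := by
  have hI : Complex.I ^ (a + b + 3 * c) * Complex.I ^ (a + b + 3 * c) = 1 := by
    obtain ⟨-, -, -, m, hm⟩ := h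
    rw [← pow_add, I_pow_congr (n := 0), pow_zero]
    rw [Nat.ModEq]
    omega
  rw [braidEigenvalue_eq h, mul_inv, inv_eq_of_mul_eq_one_left hI]

/-- The normalization `[n + 1]_q^{-1/2}` relating `6j` symbols to Racah coefficients. -/
def invSqrtDim (q : ℝ) (n : ℕ) : ℝ := qNum q ((n : ℝ) + 1) ^ (-(1 : ℝ) / 2)

theorem qNum_mul_invSqrtDim_sq {q : ℝ} (hq : q ∈ Set.Ioo (0 : ℝ) 1) (n : ℕ) :
    ((qNum q ((n : ℝ) + 1) : ℝ) : ℂ) * (invSqrtDim q n : ℂ) ^ 2 = 1 := by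
  have h : 0 < qNum q ((n : ℝ) + 1) := qNum_pos hq (by positivity)
  rw [← Complex.ofReal_pow, ← Complex.ofReal_mul, invSqrtDim, ← Real.rpow_mul_natCast h.le]
  norm_num [Real.rpow_neg_one, h.ne']

theorem sixJ_eq {a b c d n : ℕ} (h : Triad a b c) (h' : Triad c d n) (p : ℕ) :
    sixJ hq a b c d n p = Complex.I ^ (a + b + d + n) *
      ((invSqrtDim q p : ℂ) * (invSqrtDim q c : ℂ)) * racah hq a b d c n p := by
  have heven : Even (b + d + n + a) := by
    obtain ⟨⟨-, -, -, k, hk⟩, ⟨-, -, -, l, hl⟩⟩ := h, h'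
    rw [Nat.even_iff]
    omega
  rw [sixJ, neg_one_pow_half_eq_I_pow heven, invSqrtDim, invSqrtDim,
    Real.mul_rpow (qNum_pos hq (by positivity)).le (qNum_pos hq (by positivity)).le,
    Complex.ofReal_mul, add_comm (b + d + n), add_assoc b, ← add_assoc a, ← add_assoc]

/-- The factor, independent of the summation variable, by which the two sums of products of `6j`
symbols differ from the sums of products of Racah coefficients and braiding eigenvalues. -/
def yangBaxterFactor (q : ℝ) (n₁ n₂ n₃ n₄ n₅ n₆ n₇ n₈ n₉ : ℕ) : ℂ :=
  Complex.I ^ (3 * n₁ + 2 * n₂ + 2 * n₃ + n₅ + n₆ + n₇ + n₉) *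
    ((q ^ (-(casimir n₉ - casimir n₁ + casimir n₈ + casimir n₆ + casimir n₄) / 2) : ℝ) : ℂ) *
    (invSqrtDim q n₈ * invSqrtDim q n₇ * invSqrtDim q n₅ * invSqrtDim q n₄ : ℂ)

theorem left_sign_eq {n₁ n₉ x : ℕ} (h₁₉ : Triad n₁ n₉ x) (n₂ n₃ n₅ n₆ n₇ : ℕ) :
    Complex.I ^ (2 * x) * Complex.I ^ (n₂ + n₇ + n₁ + n₉) * Complex.I ^ (n₂ + n₆ + n₃ + x) *
      Complex.I ^ (n₁ + n₅ + n₃ + n₉) =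
    Complex.I ^ (3 * n₁ + 2 * n₂ + 2 * n₃ + n₅ + n₆ + n₇ + n₉) *
      Complex.I ^ (n₁ + x + 3 * n₉) := by
  obtain ⟨-, -, -, k, hk⟩ := h₁₉
  simp only [← pow_add]
  refine I_pow_congr ?_
  rw [Nat.ModEq]
  omega

theorem left_summand_eq {n₁ n₂ n₃ n₄ n₅ n₆ n₇ n₉ x : ℕ} (h₁₄₅ : Triad n₁ n₄ n₅)
    (h₂₅₆ : Triad n₂ n₅ n₆) (h₃₄₉ : Triad n₃ n₄ n₉) (h₁₉ : Triad n₁ n₉ x) (h₂₇ : Triad n₂ n₇ x)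
    (h₃₅ : Triad n₃ n₅ x) (n₈ : ℕ) :
    (-1 : ℂ) ^ x * ((qNum q ((x : ℝ) + 1) : ℝ) : ℂ) *
        ((q ^ (-(casimir x + casimir n₈ + casimir n₆ + casimir n₄) / 2) : ℝ) : ℂ) *
        sixJ hq n₂ n₇ x n₁ n₉ n₈ * sixJ hq n₂ n₆ n₅ n₃ x n₇ * sixJ hq n₁ n₅ n₄ n₃ n₉ x =
      yangBaxterFactor q n₁ n₂ n₃ n₄ n₅ n₆ n₇ n₈ n₉ *
        (racah hq n₁ n₅ n₃ n₄ n₉ x * racah hq n₂ n₆ n₃ n₅ x n₇ *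
          (braidEigenvalue q n₁ x n₉ * racah hq n₂ n₇ n₁ x n₉ n₈)) := by
  have h_rpow : q ^ (-(casimir x + casimir n₈ + casimir n₆ + casimir n₄) / 2) =
      q ^ (-(casimir n₉ - casimir n₁ + casimir n₈ + casimir n₆ + casimir n₄) / 2) *
        q ^ ((casimir n₉ - casimir n₁ - casimir x) / 2) := by
    rw [← Real.rpow_add hq.1]
    ring_nf
  rw [neg_one_pow_eq_I_pow, sixJ_eq hq h₂₇ h₁₉.rotate, sixJ_eq hq h₂₅₆.rotate.swap h₃₅.swap,
    sixJ_eq hq h₁₄₅.rotate.swap h₃₄₉.swap, braidEigenvalue_eq h₁₉.rotate.swap, h_rpow,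
    Complex.ofReal_mul, yangBaxterFactor]
  set Q : ℂ :=
    ((q ^ (-(casimir n₉ - casimir n₁ + casimir n₈ + casimir n₆ + casimir n₄) / 2) : ℝ) : ℂ)
  set Qx : ℂ := ((q ^ ((casimir n₉ - casimir n₁ - casimir x) / 2) : ℝ) : ℂ)
  calc
    _ = (Complex.I ^ (2 * x) * Complex.I ^ (n₂ + n₇ + n₁ + n₉) * Complex.I ^ (n₂ + n₆ + n₃ + x) *
          Complex.I ^ (n₁ + n₅ + n₃ + n₉)) *
        (((qNum q ((x : ℝ) + 1) : ℝ) : ℂ) * (invSqrtDim q x : ℂ) ^ 2) * (Q * Qx) *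
        (invSqrtDim q n₈ * invSqrtDim q n₇ * invSqrtDim q n₅ * invSqrtDim q n₄) *
        (racah hq n₁ n₅ n₃ n₄ n₉ x * racah hq n₂ n₆ n₃ n₅ x n₇ * racah hq n₂ n₇ n₁ x n₉ n₈) := by
      ring
    _ = _ := by
      rw [left_sign_eq h₁₉, qNum_mul_invSqrtDim_sq hq]
      ring

theorem right_sign_eq {n₁ n₄ n₅ n₇ n₈ : ℕ} (h₁₄₅ : Triad n₁ n₄ n₅) (h₁₇₈ : Triad n₁ n₇ n₈)
    (n₂ n₃ n₆ n₉ x : ℕ) :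
    Complex.I ^ (2 * x) * Complex.I ^ (n₁ + n₆ + n₃ + n₈) * Complex.I ^ (n₂ + x + n₃ + n₉) *
      Complex.I ^ (n₂ + n₆ + n₁ + n₄) =
    Complex.I ^ (3 * n₁ + 2 * n₂ + 2 * n₃ + n₅ + n₆ + n₇ + n₉) *
      Complex.I ^ (n₁ + n₅ + 3 * n₄) * Complex.I ^ (n₁ + n₆ + 3 * x) *
      Complex.I ^ (n₁ + n₇ + 3 * n₈) := by
  obtain ⟨⟨-, -, -, k, hk⟩, ⟨-, -, -, l, hl⟩⟩ := h₁₄₅, h₁₇₈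
  simp only [← pow_add]
  refine I_pow_congr ?_
  rw [Nat.ModEq]
  omega

theorem right_summand_eq {n₁ n₂ n₃ n₄ n₅ n₆ n₇ n₈ n₉ x : ℕ} (h₁₄₅ : Triad n₁ n₄ n₅)
    (h₁₇₈ : Triad n₁ n₇ n₈) (h₂₅₆ : Triad n₂ n₅ n₆) (h₃₄₉ : Triad n₃ n₄ n₉)
    (h₁₆ : Triad n₁ n₆ x) (h₂₄ : Triad n₂ n₄ x) (h₃₈ : Triad n₃ n₈ x) :
    (-1 : ℂ) ^ x * ((qNum q ((x : ℝ) + 1) : ℝ) : ℂ) *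
        ((q ^ (-(casimir x + casimir n₇ + casimir n₉ + casimir n₅) / 2) : ℝ) : ℂ) *
        sixJ hq n₁ n₆ x n₃ n₈ n₇ * sixJ hq n₂ x n₄ n₃ n₉ n₈ * sixJ hq n₂ n₆ n₅ n₁ n₄ x =
      yangBaxterFactor q n₁ n₂ n₃ n₄ n₅ n₆ n₇ n₈ n₉ *
        (braidEigenvalue q n₁ n₇ n₈ * (braidEigenvalue q n₁ n₅ n₄ * racah hq n₂ n₆ n₁ n₅ n₄ x *
          (braidEigenvalue q n₁ n₆ x)⁻¹ * racah hq n₁ n₆ n₃ x n₈ n₇) *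
            racah hq n₂ x n₃ n₄ n₉ n₈) := by
  have h_rpow : q ^ (-(casimir x + casimir n₇ + casimir n₉ + casimir n₅) / 2) =
      q ^ (-(casimir n₉ - casimir n₁ + casimir n₈ + casimir n₆ + casimir n₄) / 2) *
        q ^ ((casimir n₄ - casimir n₁ - casimir n₅) / 2) *
        (q ^ ((casimir x - casimir n₁ - casimir n₆) / 2))⁻¹ *
        q ^ ((casimir n₈ - casimir n₁ - casimir n₇) / 2) := by
    rw [← Real.rpow_neg hq.1.le, ← Real.rpow_add hq.1, ← Real.rpow_add hq.1, ← Real.rpow_add hq.1]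
    ring_nf
  rw [neg_one_pow_eq_I_pow, sixJ_eq hq h₁₆ h₃₈.rotate, sixJ_eq hq h₂₄.rotate.swap h₃₄₉.swap,
    sixJ_eq hq h₂₅₆.rotate.swap h₁₄₅.rotate, braidEigenvalue_eq h₁₄₅.rotate.swap,
    inv_braidEigenvalue_eq h₁₆, braidEigenvalue_eq h₁₇₈, h_rpow, Complex.ofReal_mul,
    Complex.ofReal_mul, Complex.ofReal_mul, Complex.ofReal_inv, yangBaxterFactor]
  set Q : ℂ :=
    ((q ^ (-(casimir n₉ - casimir n₁ + casimir n₈ + casimir n₆ + casimir n₄) / 2) : ℝ) : ℂ)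
  set Q₄ : ℂ := ((q ^ ((casimir n₄ - casimir n₁ - casimir n₅) / 2) : ℝ) : ℂ)
  set Qx : ℂ := ((q ^ ((casimir x - casimir n₁ - casimir n₆) / 2) : ℝ) : ℂ)⁻¹
  set Q₈ : ℂ := ((q ^ ((casimir n₈ - casimir n₁ - casimir n₇) / 2) : ℝ) : ℂ)
  calc
    _ = (Complex.I ^ (2 * x) * Complex.I ^ (n₁ + n₆ + n₃ + n₈) * Complex.I ^ (n₂ + x + n₃ + n₉) *
          Complex.I ^ (n₂ + n₆ + n₁ + n₄)) *
        (((qNum q ((x : ℝ) + 1) : ℝ) : ℂ) * (invSqrtDim q x : ℂ) ^ 2) * (Q * Q₄ * Qx * Q₈) *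
        (invSqrtDim q n₈ * invSqrtDim q n₇ * invSqrtDim q n₅ * invSqrtDim q n₄) *
        (racah hq n₂ n₆ n₁ n₅ n₄ x * racah hq n₂ x n₃ n₄ n₉ n₈ * racah hq n₁ n₆ n₃ x n₈ n₇) := by
      ring
    _ = _ := by
      rw [right_sign_eq h₁₄₅ h₁₇₈, qNum_mul_invSqrtDim_sq hq]
      ring

end QSixJ

end

/-- The Yang–Baxter (IRF) identity for `q`-`6j` symbols. The spins are `jᵢ = nᵢ / 2`; the summation
variable `x` is `2 j₁₀`. -/
theorem mainTheorem12 {q : ℝ} (hq : q ∈ Set.Ioo (0 : ℝ) 1) (n₁ n₂ n₃ n₄ n₅ n₆ n₇ n₈ n₉ : ℕ)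
    (h145 : QSixJ.Triad n₁ n₄ n₅) (h178 : QSixJ.Triad n₁ n₇ n₈) (h256 : QSixJ.Triad n₂ n₅ n₆)
    (h289 : QSixJ.Triad n₂ n₈ n₉) (h367 : QSixJ.Triad n₃ n₆ n₇) (h349 : QSixJ.Triad n₃ n₄ n₉) :
    ∑ x ∈ Finset.range (n₁ + n₉ + 1) with
        QSixJ.Triad n₁ n₉ x ∧ QSixJ.Triad n₂ n₇ x ∧ QSixJ.Triad n₃ n₅ x,
      (-1 : ℂ) ^ x * ((QSixJ.qNum q ((x : ℝ) + 1) : ℝ) : ℂ) *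
        ((q ^ (-(QSixJ.casimir x + QSixJ.casimir n₈ + QSixJ.casimir n₆ + QSixJ.casimir n₄) / 2) :
          ℝ) : ℂ) *
        QSixJ.sixJ hq n₂ n₇ x n₁ n₉ n₈ *
        QSixJ.sixJ hq n₂ n₆ n₅ n₃ x n₇ *
        QSixJ.sixJ hq n₁ n₅ n₄ n₃ n₉ x =
    ∑ x ∈ Finset.range (n₁ + n₆ + 1) with
        QSixJ.Triad n₁ n₆ x ∧ QSixJ.Triad n₂ n₄ x ∧ QSixJ.Triad n₃ n₈ x,
      (-1 : ℂ) ^ x * ((QSixJ.qNum q ((x : ℝ) + 1) : ℝ) : ℂ) *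
        ((q ^ (-(QSixJ.casimir x + QSixJ.casimir n₇ + QSixJ.casimir n₉ + QSixJ.casimir n₅) / 2) :
          ℝ) : ℂ) *
        QSixJ.sixJ hq n₁ n₆ x n₃ n₈ n₇ *
        QSixJ.sixJ hq n₂ x n₄ n₃ n₉ n₈ *
        QSixJ.sixJ hq n₂ n₆ n₅ n₁ n₄ x := by
  have key := congrArg (QSixJ.yangBaxterFactor q n₁ n₂ n₃ n₄ n₅ n₆ n₇ n₈ n₉ * ·)
    (QSixJ.racah_yangBaxter hq (n₄ := n₄) (n₅ := n₅) h178 h289 h367.swap)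
  simp only [Finset.mul_sum] at key
  refine Eq.trans (Finset.sum_congr rfl fun x hx => ?_)
    (key.trans (Finset.sum_congr rfl fun x hx => ?_))
  · obtain ⟨h19, h27, h35⟩ := (Finset.mem_filter.1 hx).2
    exact QSixJ.left_summand_eq hq h145 h256 h349 h19 h27 h35 n₈
  · obtain ⟨h16, h24, h38⟩ := (Finset.mem_filter.1 hx).2
    exact (QSixJ.right_summand_eq hq h145 h178 h256 h349 h16 h24 h38).symm
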